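/- Let $\alpha,\alpha',\beta,\beta',\gamma,\rho,p,b,c\in\mathbb{C}$ and $x>0$, put $\kappa:=p+\frac{b+1}{2}$, and suppose that $\kappa\notin\{0,-1,-2,\dots\}$, $\operatorname{Re}(\gamma)>0$ and $$\operatorname{Re}(\rho-p)<1+\min\{\operatorname{Re}(-\beta),\ \operatorname{Re}(\alpha+\alpha'-\gamma),\ \operatorname{Re}(\alpha+\beta'-\gamma)\}.$$ Suppose also that none of $p-\rho+1$, $\alpha+\alpha'+\beta'+p-\gamma-\rho+1$, $\alpha-\beta+p-\rho+1$ is zero or a negative integer (so that the hypergeometric series below is defined). Let $\mathcal{W}_{p,b,c}(z)=\sum_{k=0}^{\infty}\frac{(-1)^k c^k}{\Gamma(\kappa+k)\,k!}\left(\frac z2\right)^{2k+p}$ be the generalized Bessel function of the first kind, and let $$\left(I_{0,-}^{\alpha,\alpha',\beta,\beta',\gamma}f\right)(x)=\frac{x^{-\alpha'}}{\Gamma(\gamma)}\int_x^{\infty}(t-x)^{\gamma-1}t^{-\alpha}F_3\left(\alpha,\alpha',\beta,\beta';\gamma;1-\frac xt,1-\frac tx\right)f(t)\,dt$$ be the right-sided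 Marichev–Saigo–Maeda fractional integral, where $F_3(a,a',b,b';c;u,v)$ is the principal branch of the third Appell function, that is, the double series $\sum_{m,n\ge 0}\frac{(a)_m(a')_n(b)_m(b')_n}{(c)_{m+n}\,m!\,n!}u^mv^n$ for $|u|,|v|<1$, continued analytically along the segment from $(0,0)$ to $(u,v)$. Then for $f(t)=t^{\rho-1}\mathcal{W}_{p,b,c}(1/t)$ the integral converges absolutely, and $$\left(I_{0,-}^{\alpha,\alpha',\beta,\beta',\gamma}\,t^{\rho-1}\mathcal{W}_{p,b,c}(1/t)\right)(x)=\frac{x^{\rho-p-\alpha-\alpha'+\gamma-1}}{2^p}\cdot\frac{\Gamma(\alpha+\alpha'+p-\gamma-\rho+1)\,\Gamma(\alpha+\beta'-\gamma+p-\rho+1)\,\Gamma(-\beta+p-\rho+1)}{\Gamma(p-\rho+1)\,\Gamma(\kappa)\,\Gamma(\alpha+\alpha'+\beta'+p-\gamma-\rho+1)\,\Gamma(\alpha-\beta+p-\rho+1)}\cdot{}_6F_7\left[A;B\,\Big|\,-\frac{c}{4x^2}\right],$$ where ${}_6F_7[a_1,\dots,a_6;b_1,\dots,b_7\,|\,z]=\sum_{k=0}^{\infty}\frac{(a_1)_k\cdots(a_6)_k}{(b_1)_k\cdots(b_7)_k\,k!}z^k$,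 the list $A$ of numerator parameters is $$\tfrac{\alpha+\alpha'+p-\gamma-\rho+1}{2},\ \tfrac{\alpha+\alpha'+p-\gamma-\rho+2}{2},\ \tfrac{\alpha+\beta'+p-\gamma-\rho+1}{2},\ \tfrac{\alpha+\beta'+p-\gamma-\rho+2}{2},\ \tfrac{-\beta+p-\rho+1}{2},\ \tfrac{-\beta+p-\rho+2}{2},$$ and the list $B$ of denominator parameters is $$\kappa,\ \tfrac{p-\rho+1}{2},\ \tfrac{p-\rho+2}{2},\ \tfrac{\alpha+\alpha'+\beta'+p-\gamma-\rho+1}{2},\ \tfrac{\alpha+\alpha'+\beta'+p-\gamma-\rho+2}{2},\ \tfrac{\alpha-\beta+p-\rho+1}{2},\ \tfrac{\alpha-\beta+p-\rho+2}{2}.$$ -/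

import Mathlib

open Filter Topology MeasureTheory

/-- `g` is a holomorphic continuation to `U` of the germ of `f` at `0`, where `U` is an open set
that is star-shaped about `0`. -/
def IsStarContinuation (f g : ℂ → ℂ) (U : Set ℂ) : Prop :=
  IsOpen U ∧ StarConvex ℝ 0 U ∧ DifferentiableOn ℂ g U ∧ f =ᶠ[𝓝 0] g

open Classical in
/-- The value at `z` of the analytic continuation of the germ of `f` at `0` along the straight
segment from `0` to `z` (and `0` if there is no continuation). -/
noncomputable def starContinuation (f : ℂ → ℂ) (z : ℂ) : ℂ :=
  if h : ∃ g : ℂ → ℂ, ∃ U : Set ℂ, IsStarContinuation f g U ∧ z ∈ U then h.choose z else 0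

/-- The continuation is well defined: every continuation gives the same value. -/
theorem starContinuation_eq {f g : ℂ → ℂ} {U : Set ℂ} (h : IsStarContinuation f g U) {z : ℂ}
    (hz : z ∈ U) : starContinuation f z = g z := by
  have hex : ∃ g : ℂ → ℂ, ∃ U : Set ℂ, IsStarContinuation f g U ∧ z ∈ U := ⟨g, U, h, hz⟩
  rw [starContinuation, dif_pos hex]
  obtain ⟨V, hV, hzV⟩ := hex.choose_spec
  obtain ⟨oU, sU, dU, eU⟩ := h
  obtain ⟨oV, sV, dV, eV⟩ := hV
  have sUV : StarConvex ℝ 0 (V ∩ U) := sV.inter sU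
  have h0 : (0 : ℂ) ∈ V ∩ U := by
    have hmem : z ∈ V ∩ U := ⟨hzV, hz⟩
    simpa using sUV hmem (zero_le_one' ℝ) le_rfl (add_zero 1)
  have oUV : IsOpen (V ∩ U) := oV.inter oU
  have pre : IsPreconnected (V ∩ U) := (sUV.isPathConnected h0).isConnected.isPreconnected
  exact ((dV.mono Set.inter_subset_left).analyticOnNhd oUV).eqOn_of_preconnected_of_eventuallyEq
    ((dU.mono Set.inter_subset_right).analyticOnNhd oUV) pre h0 (eV.symm.trans eU) ⟨hzV, hz⟩

/-- The Pochhammer symbol `(a)_k = a (a + 1) ⋯ (a + k - 1)`. -/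
noncomputable def poch (a : ℂ) (k : ℕ) : ℂ := (ascPochhammer ℂ k).eval a

/-- The double series `∑ (a)_m (a')_n (b)_m (b')_n / ((c)_{m+n} m! n!) u^m v^n` of the third Appell
function (it converges for `|u| < 1`, `|v| < 1`). -/
noncomputable def appellF3Series (a a' b b' c u v : ℂ) : ℂ :=
  ∑' k : ℕ × ℕ, poch a k.1 * poch a' k.2 * poch b k.1 * poch b' k.2 /
    (poch c (k.1 + k.2) * (k.1.factorial : ℂ) * (k.2.factorial : ℂ)) * u ^ k.1 * v ^ k.2

/-- The third Appell function `F₃(a, a', b, b'; c; u, v)`, principal branch: the double series,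
continued analytically along the straight segment `s ↦ (s u, s v)` from `(0, 0)` to `(u, v)`. -/
noncomputable def appellF3 (a a' b b' c u v : ℂ) : ℂ :=
  starContinuation (fun s => appellF3Series a a' b b' c (s * u) (s * v)) 1

/-- The integrand of the right-sided Marichev–Saigo–Maeda operator at the point `x`. -/
noncomputable def msmRightIntegrand (α α' β β' γ : ℂ) (f : ℝ → ℂ) (x t : ℝ) : ℂ :=
  ((t - x : ℝ) : ℂ) ^ (γ - 1) * (t : ℂ) ^ (-α) *
    appellF3 α α' β β' γ (1 - (x : ℂ) / t) (1 - (t : ℂ) / x) * f t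

/-- The right-sided Marichev–Saigo–Maeda fractional integral of `f` at `x > 0`. -/
noncomputable def msmRight (α α' β β' γ : ℂ) (f : ℝ → ℂ) (x : ℝ) : ℂ :=
  (x : ℂ) ^ (-α') / Complex.Gamma γ *
    ∫ t in Set.Ioi x, msmRightIntegrand α α' β β' γ f x t

/-- The generalized Bessel function of the first kind `W_{p,b,c}` (principal branch). -/
noncomputable def genBessel (p b c z : ℂ) : ℂ :=
  ∑' k : ℕ, (-1) ^ k * c ^ k / (Complex.Gamma (p + (b + 1) / 2 + k) * (k.factorial : ℂ)) *
    (z / 2) ^ (2 * (k : ℂ) + p)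

/-- The generalized hypergeometric series with numerator parameters `as` and denominator
parameters `bs`. -/
noncomputable def genHyp (as bs : List ℂ) (z : ℂ) : ℂ :=
  ∑' k : ℕ, (as.map fun a => poch a k).prod /
    ((bs.map fun b => poch b k).prod * poch 1 k) * z ^ k

/-!
The integrand involves `F₃` only on the curve `(1 - u) (1 - v) = 1`, which with `t = x / y` is
`u = 1 - y`, `v = 1 - 1 / y`, `0 < y < 1`. Pfaff's transformation in the second variable,
`v ↦ v / (v - 1)`, gives

  `F₃(a, a', b, b'; c; u, v) = (1 - v) ^ (-a') ∑ T(m, n) u ^ m (v / (v - 1)) ^ n`,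

with `T = pfaffCoeff`. Along the segment `s ↦ (s u, s v)` the right-hand side is holomorphic near
`[0, 1]` (`isStarContinuation_pfaff`), so it is the continuation of the series, and since
`v / (v - 1) = u` on the curve, its value at `s = 1` is `y ^ a' ∑ T(m, n) (1 - y) ^ (m + n)`
(`appellF3Curve_eq_tsum`).

The Mellin transform `∫₀¹ y ^ (s - 1) (1 - y) ^ (c - 1) F₃ dy` is therefore a double series of Beta
integrals, which Gauss's theorem `tsum_gaussTerm` sums twice, first over `n` and then over `m`, to a
quotient of Gamma functions (`curveMellin`). Uniform power bounds for quotients of Pochhammer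
symbols (`exists_norm_poch_div_poch_le`) show that, for `0 < Re a'`, the double series converges
absolutely on the whole region where the formula is claimed. For other `a'` there is cancellation
in the series, and the formula is reached by induction from the contiguous relation

  `F₃(a, a', b, b'; c) = F₃(a, a' + 1, b, b'; c) - (b' v / c) F₃(a, a' + 1, b, b' + 1; c + 1)`,

which preserves the region of validity (`mellin_appellF3Curve`).

The generalized Bessel function contributes an entire even series in `y`, bounded on `(0, 1)`, so
the sum over its index `k` may be taken outside the integral; the `k`-th term is the Mellin
transform at `s + 2 k`, and the duplication formula for `(z)_{2k}` turns the sum into `₆F₇`.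
-/

/-! ### Pochhammer symbols and the Gamma function -/

@[simp] lemma poch_zero (a : ℂ) : poch a 0 = 1 := by simp [poch]

lemma poch_succ (a : ℂ) (n : ℕ) : poch a (n + 1) = poch a n * (a + n) := by
  simp [poch, ascPochhammer_succ_eval]

lemma poch_add (a : ℂ) (m n : ℕ) : poch a (m + n) = poch a m * poch (a + m) n := by
  induction n with
  | zero => simp
  | succ n ih => rw [← add_assoc, poch_succ, ih, poch_succ]; push_cast; ring

lemma poch_succ_left (a : ℂ) (n : ℕ) : poch a (n + 1) = a * poch (a + 1) n := by
  rw [add_comm, poch_add]; simp [poch_succ]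

lemma poch_one (n : ℕ) : poch 1 n = n.factorial := by simp [poch, ascPochhammer_eval_one]

lemma poch_ne_zero {a : ℂ} (ha : ∀ n : ℕ, a ≠ -(n : ℂ)) (n : ℕ) : poch a n ≠ 0 := by
  induction n with
  | zero => simp
  | succ n ih =>
    rw [poch_succ]
    exact mul_ne_zero ih fun h => ha n (eq_neg_of_add_eq_zero_left h)

lemma ne_neg_natCast_of_re_pos {a : ℂ} (ha : 0 < a.re) (n : ℕ) : a ≠ -(n : ℂ) := by
  rintro rfl
  have : (0 : ℝ) ≤ n := n.cast_nonneg
  simp at ha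
  linarith

lemma poch_ne_zero_of_re_pos {a : ℂ} (ha : 0 < a.re) (n : ℕ) : poch a n ≠ 0 :=
  poch_ne_zero (ne_neg_natCast_of_re_pos ha) n

lemma poch_two_mul (z : ℂ) (k : ℕ) :
    poch z (2 * k) = 4 ^ k * (poch (z / 2) k * poch ((z + 1) / 2) k) := by
  induction k with
  | zero => simp
  | succ k ih =>
    rw [show 2 * (k + 1) = 2 * k + 1 + 1 by ring, poch_succ, poch_succ, ih, poch_succ, poch_succ]
    push_cast
    ring

/-- Valid for every `z`, since `1 / Γ` vanishes at the poles of `Γ`. -/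
lemma inv_Gamma_eq_poch_mul (z : ℂ) (n : ℕ) :
    (Complex.Gamma z)⁻¹ = poch z n * (Complex.Gamma (z + n))⁻¹ := by
  induction n with
  | zero => simp
  | succ n ih =>
    rw [ih, poch_succ, Complex.one_div_Gamma_eq_self_mul_one_div_Gamma_add_one (z + n)]
    push_cast
    ring_nf

lemma Gamma_add_nat_eq_poch_mul {z : ℂ} (hz : ∀ n : ℕ, z ≠ -(n : ℂ)) (n : ℕ) :
    Complex.Gamma (z + n) = poch z n * Complex.Gamma z := by
  have h := inv_Gamma_eq_poch_mul z n
  have h1 := Complex.Gamma_ne_zero hz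
  have h2 : Complex.Gamma (z + n) ≠ 0 := by
    rintro h0
    rw [h0] at h
    simp [h1] at h
  field_simp at h
  rw [h, mul_comm]

/-! ### Growth of quotients of Pochhammer symbols -/

lemma norm_one_add_le_exp (z : ℂ) : ‖1 + z‖ ≤ Real.exp (z.re + ‖z‖ ^ 2 / 2) := by
  have h : ‖1 + z‖ ^ 2 ≤ Real.exp (z.re + ‖z‖ ^ 2 / 2) ^ 2 := by
    rw [← Real.exp_nat_mul, ← Complex.normSq_eq_norm_sq, ← Complex.normSq_eq_norm_sq,
      Complex.normSq_add]
    refine le_trans (le_of_eq ?_) (Real.add_one_le_exp _)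
    simp
    ring
  exact le_of_sq_le_sq h (Real.exp_pos _).le

lemma abs_log_succ_div_sub_le (k : ℕ) :
    |Real.log ((k + 2) / (k + 1)) - 1 / (k + 1)| ≤ 1 / ((k : ℝ) + 1) ^ 2 := by
  have hk : (0 : ℝ) < k + 1 := by positivity
  have h1 : Real.log (((k : ℝ) + 2) / (k + 1)) ≤ 1 / (k + 1) := by
    refine (Real.log_le_sub_one_of_pos (by positivity)).trans (le_of_eq ?_)
    field_simp; ring
  have h2 : 1 / ((k : ℝ) + 2) ≤ Real.log (((k : ℝ) + 2) / (k + 1)) := by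
    have := Real.one_sub_inv_le_log_of_pos (x := ((k : ℝ) + 2) / (k + 1)) (by positivity)
    refine le_trans (le_of_eq ?_) this
    field_simp; ring
  have h3 : 1 / ((k : ℝ) + 1) - 1 / (k + 2) ≤ 1 / ((k : ℝ) + 1) ^ 2 := by
    rw [div_sub_div _ _ (by positivity) (by positivity),
      div_le_div_iff₀ (by positivity) (by positivity)]
    nlinarith
  rw [abs_le]
  constructor <;> linarith [show 0 ≤ 1 / ((k : ℝ) + 1) ^ 2 by positivity]

/-- One factor of the quotient `(w + m)_n / (c + m)_n`: it is `((k + 2) / (k + 1)) ^ Re (w - c)` up to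
a factor whose logarithm is summable in `k`. -/
lemma exists_norm_add_div_add_le (w c : ℂ) (hc : 0 < c.re) :
    ∃ K : ℝ, 0 ≤ K ∧ ∀ k : ℕ, ‖(w + k) / (c + k)‖ ≤
      (((k : ℝ) + 2) / (k + 1)) ^ (w - c).re * Real.exp (K * (1 / ((k : ℝ) + 1) ^ 2)) := by
  -- `δ` bounds `‖c + k‖` from below by `δ (k + 1)`
  set δ : ℝ := min c.re 1 with hδ
  have hδ0 : 0 < δ := lt_min hc one_pos
  have hlow : ∀ k : ℕ, δ * (k + 1) ≤ ‖c + k‖ := fun k => by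
    have h1 : (c + k).re ≤ ‖c + k‖ := Complex.re_le_norm _
    have h2 : δ ≤ c.re := min_le_left _ _
    have h3 : δ ≤ 1 := min_le_right _ _
    have h4 : (0 : ℝ) ≤ k := k.cast_nonneg
    simp at h1
    nlinarith
  set d := w - c with hd
  refine ⟨‖d‖ * (1 + ‖c - 1‖ / δ) + ‖d‖ ^ 2 / δ ^ 2, by positivity, fun k => ?_⟩
  have hk : (0 : ℝ) < (k : ℝ) + 1 := by positivity
  have hck : (0 : ℝ) < ‖c + k‖ := lt_of_lt_of_le (by positivity) (hlow k)
  have hck0 : c + k ≠ 0 := norm_pos_iff.1 hck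
  have hkc : (k : ℂ) + 1 ≠ 0 := by exact_mod_cast hk.ne'
  have hz : (w + k) / (c + k) = 1 + d / (c + k) := by rw [hd]; field_simp; ring
  have hnz : ‖d / (c + k)‖ ≤ ‖d‖ / δ / (k + 1) := by
    rw [norm_div, div_div]
    gcongr
    exact hlow k
  have hsq : ‖d / (c + k)‖ ^ 2 ≤ ‖d‖ ^ 2 / δ ^ 2 * (1 / ((k : ℝ) + 1) ^ 2) := by
    refine (pow_le_pow_left₀ (norm_nonneg _) hnz 2).trans (le_of_eq ?_)
    field_simp
  have hre : (d / (c + k)).re ≤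
      d.re * (1 / (k + 1)) + ‖d‖ * (‖c - 1‖ / δ) * (1 / ((k : ℝ) + 1) ^ 2) := by
    have he : d / (c + k) = d * ((1 / ((k : ℝ) + 1) : ℝ) : ℂ) - d * (c - 1) / ((c + k) * (k + 1)) := by
      push_cast
      field_simp
      ring
    rw [he, Complex.sub_re, Complex.re_mul_ofReal]
    have : -(d * (c - 1) / ((c + k) * (k + 1))).re ≤ ‖d‖ * (‖c - 1‖ / δ) * (1 / ((k : ℝ) + 1) ^ 2) := by
      refine (neg_le_abs _).trans ((Complex.abs_re_le_norm _).trans ?_)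
      have hkn : ‖(k : ℂ) + 1‖ = k + 1 := by
        exact_mod_cast Complex.norm_natCast (k + 1)
      rw [norm_div, norm_mul, norm_mul, hkn]
      calc ‖d‖ * ‖c - 1‖ / (‖c + k‖ * (k + 1)) ≤ ‖d‖ * ‖c - 1‖ / ((δ * (k + 1)) * (k + 1)) := by
            gcongr
            exact hlow k
        _ = _ := by field_simp
    linarith
  have hlog : d.re * (1 / (k + 1)) ≤ d.re * Real.log (((k : ℝ) + 2) / (k + 1))
      + ‖d‖ * (1 / ((k : ℝ) + 1) ^ 2) := by
    have h1 := abs_log_succ_div_sub_le k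
    have h2 : |d.re| ≤ ‖d‖ := Complex.abs_re_le_norm _
    have h3 : -(d.re * (Real.log (((k : ℝ) + 2) / (k + 1)) - 1 / (k + 1))) ≤
        ‖d‖ * (1 / ((k : ℝ) + 1) ^ 2) := by
      refine (neg_le_abs _).trans ?_
      rw [abs_mul]
      gcongr
    linarith
  rw [hz, Real.rpow_def_of_pos (by positivity), ← Real.exp_add]
  refine (norm_one_add_le_exp _).trans (Real.exp_le_exp.2 ?_)
  have h0 : 0 ≤ ‖d‖ ^ 2 / δ ^ 2 * (1 / ((k : ℝ) + 1) ^ 2) := by positivity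
  linarith

/-- The quotient `(w + m)_n / (c + m)_n` grows like `((m + n + 1) / (m + 1)) ^ Re (w - c)`,
uniformly in `m` and `n`. -/
lemma exists_norm_poch_div_poch_le (w c : ℂ) (hc : 0 < c.re) :
    ∃ C : ℝ, 0 < C ∧ ∀ m n : ℕ, ‖poch (w + m) n / poch (c + m) n‖ ≤
      C * (((m : ℝ) + n + 1) / (m + 1)) ^ (w - c).re := by
  obtain ⟨K, hK, h⟩ := exists_norm_add_div_add_le w c hc
  have hsum : Summable fun k : ℕ => 1 / ((k : ℝ) + 1) ^ 2 := by
    have := (summable_nat_add_iff 1).2 (Real.summable_one_div_nat_pow.2 (one_lt_two))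
    exact_mod_cast this
  set S := ∑' k : ℕ, 1 / ((k : ℝ) + 1) ^ 2
  refine ⟨Real.exp (K * S), Real.exp_pos _, fun m n => ?_⟩
  have key : ‖poch (w + m) n / poch (c + m) n‖ ≤ (((m : ℝ) + n + 1) / (m + 1)) ^ (w - c).re *
      Real.exp (K * ∑ j ∈ Finset.range n, 1 / (((m + j : ℕ) : ℝ) + 1) ^ 2) := by
    induction n with
    | zero => simp [div_self (show (m : ℝ) + 1 ≠ 0 by positivity)]
    | succ n ih =>
      have hk := h (m + n)
      rw [poch_succ, poch_succ, mul_div_mul_comm, norm_mul, Finset.sum_range_succ, mul_add K,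
        Real.exp_add]
      push_cast at hk ⊢
      rw [← add_assoc w, ← add_assoc c] at hk
      refine (mul_le_mul ih hk (norm_nonneg _) (by positivity)).trans (le_of_eq ?_)
      have : ((m : ℝ) + (n + 1) + 1) / (m + 1) =
          (m + n + 1) / (m + 1) * ((m + n + 2) / (m + n + 1)) := by
        field_simp; ring
      rw [this, Real.mul_rpow (by positivity) (by positivity)]
      push_cast
      ring
  refine key.trans ?_
  rw [mul_comm]
  gcongr
  have hs : Summable fun j : ℕ => 1 / (((m + j : ℕ) : ℝ) + 1) ^ 2 := by
    simpa only [add_comm m] using (summable_nat_add_iff m).2 hsum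
  refine (hs.sum_le_tsum _ fun _ _ => by positivity).trans ?_
  have hsplit := hsum.sum_add_tsum_nat_add m
  have hnn : 0 ≤ ∑ j ∈ Finset.range m, 1 / ((j : ℝ) + 1) ^ 2 := by positivity
  simp only [add_comm m]
  linarith

lemma exists_norm_poch_div_poch_zero_le (w c : ℂ) (hc : 0 < c.re) :
    ∃ C : ℝ, 0 < C ∧ ∀ n : ℕ, ‖poch w n / poch c n‖ ≤ C * ((n : ℝ) + 1) ^ (w - c).re := by
  obtain ⟨C, hC, h⟩ := exists_norm_poch_div_poch_le w c hc
  exact ⟨C, hC, fun n => by simpa using h 0 n⟩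

lemma exists_norm_poch_div_factorial_le (w : ℂ) :
    ∃ C : ℝ, 0 < C ∧ ∀ n : ℕ, ‖poch w n / n.factorial‖ ≤ C * ((n : ℝ) + 1) ^ (w.re - 1) := by
  obtain ⟨C, hC, h⟩ := exists_norm_poch_div_poch_zero_le w 1 (by simp)
  exact ⟨C, hC, fun n => by simpa [poch_one] using h n⟩

/-! ### The theorems of Chu–Vandermonde and Gauss -/

/-- The Chu–Vandermonde identity `₂F₁(-N, x; C; 1) = (C - x)_N / (C)_N`. -/
lemma sum_neg_one_pow_choose_poch (N : ℕ) (x C : ℂ) (hC : ∀ n : ℕ, C ≠ -(n : ℂ)) :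
    ∑ n ∈ Finset.range (N + 1), (-1) ^ n * (N.choose n : ℂ) * (poch x n / poch C n) =
      poch (C - x) N / poch C N := by
  induction N generalizing x C with
  | zero => simp
  | succ N ih =>
    have hC0 : C ≠ 0 := by simpa using hC 0
    have hC1 : ∀ n : ℕ, C + 1 ≠ -(n : ℂ) := fun n h => hC (n + 1) (by push_cast; linear_combination h)
    have hCN : C + N ≠ 0 := fun h => hC N (eq_neg_of_add_eq_zero_left h)
    have e1 : ∑ n ∈ Finset.range (N + 1), (-1) ^ n * (N.choose n : ℂ) * (poch x n / poch C n) =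
        1 + ∑ n ∈ Finset.range (N + 1),
          (-1) ^ (n + 1) * (N.choose (n + 1) : ℂ) * (poch x (n + 1) / poch C (n + 1)) := by
      have := Finset.sum_range_succ'
        (fun n => (-1) ^ n * (N.choose n : ℂ) * (poch x n / poch C n)) (N + 1)
      rw [Finset.sum_range_succ] at this
      simp at this
      rw [this, add_comm]
    have e2 : ∑ n ∈ Finset.range (N + 1),
          (-1) ^ (n + 1) * (N.choose n : ℂ) * (poch x (n + 1) / poch C (n + 1)) =
        -(x / C) * ∑ n ∈ Finset.range (N + 1),
          (-1) ^ n * (N.choose n : ℂ) * (poch (x + 1) n / poch (C + 1) n) := by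
      rw [Finset.mul_sum]
      refine Finset.sum_congr rfl fun n _ => ?_
      rw [poch_succ_left, poch_succ_left, mul_div_mul_comm]
      ring
    rw [Finset.sum_range_succ']
    simp only [Nat.choose_succ_succ, Nat.cast_add, mul_add, add_mul, Finset.sum_add_distrib]
    rw [e2, ih (x + 1) (C + 1) hC1]
    have e3 := ih x C hC
    rw [e1] at e3
    have e4 : poch (C + 1) N * C = poch C N * (C + N) := by
      rw [← poch_succ, poch_succ_left]; ring
    have hp := poch_ne_zero hC N
    have hp1 := poch_ne_zero hC1 N
    rw [poch_succ (C - x), poch_succ C, show C + 1 - (x + 1) = C - x by ring]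
    have e5 : poch (C - x) N / poch (C + 1) N = poch (C - x) N * C / (poch C N * (C + N)) := by
      rw [← e4]; field_simp
    rw [e5]
    simp only [pow_zero, Nat.choose_zero_right, poch_zero]
    have e6 : ∀ A : ℂ, 1 + A = poch (C - x) N / poch C N →
        -(x / C) * (poch (C - x) N * C / (poch C N * (C + N))) + A + 1 * ((1 : ℕ) : ℂ) * (1 / 1) =
          poch (C - x) N * (C - x + N) / (poch C N * (C + N)) := by
      intro A hA
      obtain rfl : A = poch (C - x) N / poch C N - 1 := by linear_combination hA
      field_simp
      push_cast
      ring
    exact e6 _ e3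

/-- The reciprocal Gamma function makes this bound valid for every `c`, poles included. -/
lemma exists_norm_inv_Gamma_add_nat_le (c : ℂ) :
    ∃ C : ℝ, 0 < C ∧ ∀ n : ℕ,
      ‖n.factorial * (Complex.Gamma (c + n))⁻¹‖ ≤ C * ((n : ℝ) + 1) ^ (1 - c.re) := by
  obtain ⟨M, hM⟩ := exists_nat_gt (-c.re)
  induction M generalizing c with
  | zero =>
    have hc : 0 < c.re := by simpa using hM
    obtain ⟨C, hC, h⟩ := exists_norm_poch_div_poch_zero_le 1 c hc
    have hG := Complex.Gamma_ne_zero_of_re_pos hc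
    refine ⟨C * ‖(Complex.Gamma c)⁻¹‖, mul_pos hC (norm_pos_iff.2 (inv_ne_zero hG)), fun n => ?_⟩
    have h1 := h n
    rw [Gamma_add_nat_eq_poch_mul (ne_neg_natCast_of_re_pos hc), mul_inv, ← mul_assoc, norm_mul]
    rw [poch_one] at h1
    simp only [Complex.sub_re, Complex.one_re] at h1
    calc _ ≤ (C * ((n : ℝ) + 1) ^ (1 - c.re)) * ‖(Complex.Gamma c)⁻¹‖ :=
          mul_le_mul_of_nonneg_right h1 (norm_nonneg _)
      _ = _ := by ring
  | succ M ih =>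
    obtain ⟨C, hC, h⟩ := ih (c + 1) (by push_cast at hM; simp; linarith)
    refine ⟨(‖c‖ + 1) * C, by positivity, fun n => ?_⟩
    rw [Complex.one_div_Gamma_eq_self_mul_one_div_Gamma_add_one, mul_left_comm, norm_mul,
      add_right_comm]
    have h1 : ‖c + n‖ ≤ (‖c‖ + 1) * ((n : ℝ) + 1) := by
      refine (norm_add_le _ _).trans ?_
      rw [Complex.norm_natCast]
      nlinarith [norm_nonneg c, (n.cast_nonneg : (0 : ℝ) ≤ n)]
    have h2 : ((n : ℝ) + 1) ^ (1 - c.re) = (n + 1) * ((n : ℝ) + 1) ^ (1 - (c + 1).re) := by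
      rw [show 1 - c.re = 1 + (1 - (c + 1).re) by simp; ring, Real.rpow_add (by positivity),
        Real.rpow_one]
    rw [h2]
    calc _ ≤ ((‖c‖ + 1) * ((n : ℝ) + 1)) * (C * ((n : ℝ) + 1) ^ (1 - (c + 1).re)) :=
          mul_le_mul h1 (h n) (norm_nonneg _) (by positivity)
      _ = _ := by ring

lemma summable_nat_add_one_rpow {p : ℝ} (hp : p < -1) : Summable fun n : ℕ => ((n : ℝ) + 1) ^ p := by
  have := (summable_nat_add_iff 1).2 (Real.summable_nat_rpow.2 hp)
  exact_mod_cast this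

/-- The general term of the regularised Gauss series `₂F₁(a, b; c; 1) / Γ(c)`. -/
noncomputable def gaussTerm (a b c : ℂ) (n : ℕ) : ℂ :=
  poch a n * poch b n / n.factorial * (Complex.Gamma (c + n))⁻¹

lemma exists_norm_gaussTerm_le (a b c : ℂ) :
    ∃ C : ℝ, 0 < C ∧ ∀ n : ℕ, ‖gaussTerm a b c n‖ ≤ C * ((n : ℝ) + 1) ^ ((a + b - c).re - 1) := by
  obtain ⟨A, hA, ha⟩ := exists_norm_poch_div_factorial_le a
  obtain ⟨B, hB, hb⟩ := exists_norm_poch_div_factorial_le b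
  obtain ⟨D, hD, hd⟩ := exists_norm_inv_Gamma_add_nat_le c
  refine ⟨A * B * D, by positivity, fun n => ?_⟩
  have hn : (0 : ℝ) < (n : ℝ) + 1 := by positivity
  have e : gaussTerm a b c n = poch a n / n.factorial * (poch b n / n.factorial) *
      (n.factorial * (Complex.Gamma (c + n))⁻¹) := by
    have : (n.factorial : ℂ) ≠ 0 := by exact_mod_cast n.factorial_ne_zero
    rw [gaussTerm]; field_simp
  rw [e, norm_mul, norm_mul]
  calc _ ≤ A * ((n : ℝ) + 1) ^ (a.re - 1) * (B * ((n : ℝ) + 1) ^ (b.re - 1)) *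
        (D * ((n : ℝ) + 1) ^ (1 - c.re)) := by
        gcongr
        exacts [ha n, hb n, hd n]
    _ = A * B * D * (((n : ℝ) + 1) ^ (a.re - 1) * ((n : ℝ) + 1) ^ (b.re - 1) *
        ((n : ℝ) + 1) ^ (1 - c.re)) := by ring
    _ = _ := by
      rw [← Real.rpow_add hn, ← Real.rpow_add hn]
      congr 2
      simp
      ring

lemma summable_gaussTerm {a b c : ℂ} (h : 0 < (c - a - b).re) : Summable (gaussTerm a b c) := by
  obtain ⟨C, -, hC⟩ := exists_norm_gaussTerm_le a b c
  refine Summable.of_norm_bounded ((summable_nat_add_one_rpow ?_).mul_left C) hC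
  simp at h ⊢
  linarith

/-- The contiguous relation `(c - a - b) F(c) = (c - a) (c - b) F(c + 1)`: the difference of the
two sides telescopes. -/
lemma tsum_gaussTerm_add_one {a b c : ℂ} (h : 0 < (c - a - b).re) :
    (c - a - b) * ∑' n, gaussTerm a b c n =
      (c - a) * (c - b) * ∑' n, gaussTerm a b (c + 1) n := by
  have s0 := summable_gaussTerm h
  have s1 : Summable (gaussTerm a b (c + 1)) := summable_gaussTerm (by simp at h ⊢; linarith)
  have htel : ∀ n : ℕ, (c - a - b) * gaussTerm a b c n - (c - a) * (c - b) * gaussTerm a b (c + 1) n =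
      n * gaussTerm a b c n - (n + 1 : ℕ) * gaussTerm a b c (n + 1) := by
    intro n
    have hf : (n.factorial : ℂ) ≠ 0 := by exact_mod_cast n.factorial_ne_zero
    have hn : (n : ℂ) + 1 ≠ 0 := by exact_mod_cast n.succ_ne_zero
    simp only [gaussTerm]
    rw [Complex.one_div_Gamma_eq_self_mul_one_div_Gamma_add_one (c + n), poch_succ, poch_succ,
      Nat.factorial_succ, show c + 1 + n = c + n + 1 by ring,
      show c + ((n + 1 : ℕ) : ℂ) = c + n + 1 by push_cast; ring]
    push_cast
    field_simp
    ring
  have hlim : Tendsto (fun n : ℕ => (n : ℂ) * gaussTerm a b c n) atTop (𝓝 0) := by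
    obtain ⟨C, hC0, hC⟩ := exists_norm_gaussTerm_le a b c
    have hz : Tendsto (fun n : ℕ => C * ((n : ℝ) + 1) ^ (-(c - a - b).re)) atTop (𝓝 0) := by
      have := ((tendsto_rpow_neg_atTop h).comp
        (tendsto_natCast_atTop_atTop.comp (tendsto_add_atTop_nat 1))).const_mul C
      simpa using this
    refine squeeze_zero_norm (fun n => ?_) hz
    rw [norm_mul, Complex.norm_natCast]
    have hn : (0 : ℝ) < (n : ℝ) + 1 := by positivity
    calc (n : ℝ) * ‖gaussTerm a b c n‖ ≤ ((n : ℝ) + 1) * (C * ((n : ℝ) + 1) ^ ((a + b - c).re - 1)) := by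
          gcongr
          · linarith
          · exact hC n
      _ = C * (((n : ℝ) + 1) ^ (1 : ℝ) * ((n : ℝ) + 1) ^ ((a + b - c).re - 1)) := by
          rw [Real.rpow_one]; ring
      _ = _ := by
          rw [← Real.rpow_add hn]
          congr 2
          simp
          ring
  have hs := ((s0.mul_left (c - a - b)).sub (s1.mul_left ((c - a) * (c - b)))).hasSum.tendsto_sum_nat
  have hs' : Tendsto (fun N => ∑ n ∈ Finset.range N, ((c - a - b) * gaussTerm a b c n -
      (c - a) * (c - b) * gaussTerm a b (c + 1) n)) atTop (𝓝 0) := by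
    simp_rw [htel]
    have : ∀ N : ℕ, ∑ n ∈ Finset.range N, ((n : ℂ) * gaussTerm a b c n -
        (n + 1 : ℕ) * gaussTerm a b c (n + 1)) = -((N : ℂ) * gaussTerm a b c N) := fun N => by
      rw [Finset.sum_range_sub' (fun n : ℕ => (n : ℂ) * gaussTerm a b c n)]
      simp
    simp_rw [this]
    simpa using hlim.neg
  have he := tendsto_nhds_unique hs hs'
  rw [Summable.tsum_sub (s0.mul_left _) (s1.mul_left _), tsum_mul_left, tsum_mul_left] at he
  exact sub_eq_zero.1 he

lemma tsum_gaussTerm_add_nat {a b c : ℂ} (h : 0 < (c - a - b).re) (N : ℕ) :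
    poch (c - a - b) N * ∑' n, gaussTerm a b c n =
      poch (c - a) N * poch (c - b) N * ∑' n, gaussTerm a b (c + N) n := by
  induction N with
  | zero => simp
  | succ N ih =>
    have hN : (0 : ℝ) ≤ N := N.cast_nonneg
    have := tsum_gaussTerm_add_one (a := a) (b := b) (c := c + N) (by simp at h ⊢; linarith)
    rw [poch_succ, poch_succ, poch_succ, mul_right_comm, ih, Nat.cast_add, Nat.cast_one, ← add_assoc]
    linear_combination poch (c - a) N * poch (c - b) N * this

lemma norm_poch_re_le {x : ℝ} {z : ℂ} (hx : 0 ≤ x) (h : x ≤ z.re) (n : ℕ) :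
    ‖poch x n‖ ≤ ‖poch z n‖ := by
  induction n with
  | zero => simp
  | succ n ih =>
    rw [poch_succ, poch_succ, norm_mul, norm_mul]
    refine mul_le_mul ih ?_ (norm_nonneg _) (norm_nonneg _)
    have h1 : ‖(x : ℂ) + n‖ = x + n := by
      rw [← Complex.ofReal_natCast, ← Complex.ofReal_add, Complex.norm_real,
        Real.norm_of_nonneg (by positivity)]
    rw [h1]
    refine le_trans ?_ (Complex.re_le_norm _)
    simpa using h

/-- `₂F₁(a, b; c + N; 1) → 1` as `N → ∞`. -/
lemma tendsto_tsum_poch_div_add_nat {a b c : ℂ} (hc : 0 < c.re) (h : 0 < (c - a - b).re) :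
    Tendsto (fun N : ℕ => ∑' n : ℕ, poch a n * poch b n / (n.factorial * poch (c + N) n)) atTop
      (𝓝 1) := by
  have hone : (1 : ℂ) = ∑' n : ℕ, if n = 0 then (1 : ℂ) else 0 := by simp
  rw [hone]
  have hb : ∀ N n : ℕ, ‖poch (c.re : ℂ) n‖ ≤ ‖poch (c + N) n‖ := fun N n =>
    norm_poch_re_le hc.le (by simp) n
  have hpos : ∀ n : ℕ, 0 < ‖poch (c.re : ℂ) n‖ := fun n =>
    norm_pos_iff.2 (poch_ne_zero_of_re_pos (by simpa using hc) n)
  have hfac : ∀ n : ℕ, (0 : ℝ) < ‖(n.factorial : ℂ)‖ := fun n =>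
    norm_pos_iff.2 (by exact_mod_cast n.factorial_ne_zero)
  refine tendsto_tsum_of_dominated_convergence
    (bound := fun n => ‖poch a n / n.factorial * (poch b n / poch (c.re : ℂ) n)‖) ?_ ?_ ?_
  · obtain ⟨A, hA, ha⟩ := exists_norm_poch_div_factorial_le a
    obtain ⟨B, hB, hb⟩ := exists_norm_poch_div_poch_zero_le b (c.re : ℂ) (by simpa using hc)
    refine Summable.of_nonneg_of_le (fun _ => norm_nonneg _) (fun n => ?_)
      ((summable_nat_add_one_rpow (p := a.re - 1 + (b.re - c.re)) ?_).mul_left (A * B))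
    · rw [norm_mul, Real.rpow_add (by positivity)]
      calc _ ≤ (A * ((n : ℝ) + 1) ^ (a.re - 1)) * (B * ((n : ℝ) + 1) ^ (b - (c.re : ℂ)).re) :=
            mul_le_mul (ha n) (hb n) (norm_nonneg _) (by positivity)
        _ = _ := by simp; ring
    · simp at h; linarith
  · intro n
    rcases n with _ | k
    · simp
    · simp only [Nat.succ_ne_zero, if_false]
      have hz : Tendsto (fun N : ℕ => ‖poch a (k + 1) * poch b (k + 1)‖ /
          (‖((k + 1).factorial : ℂ)‖ * ‖poch (c.re : ℂ) k‖) / ((N : ℝ) + k)) atTop (𝓝 0) :=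
        Tendsto.div_atTop tendsto_const_nhds
          (tendsto_atTop_add_const_right _ _ tendsto_natCast_atTop_atTop)
      refine squeeze_zero_norm' ?_ hz
      filter_upwards [eventually_gt_atTop 0] with N hN
      have hN' : (0 : ℝ) < N := by exact_mod_cast hN
      have h1 : (N : ℝ) + k ≤ ‖c + N + k‖ := by
        refine le_trans ?_ (Complex.re_le_norm _)
        simp
        linarith
      have h2 := hpos k
      have h3 := hfac (k + 1)
      rw [norm_div, norm_mul ((k + 1).factorial : ℂ), poch_succ (c + N), norm_mul (poch (c + N) k), div_div,
        mul_assoc]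
      gcongr
      exact hb N k
  · refine Eventually.of_forall fun N n => ?_
    have h2 := hpos n
    have h3 := hfac n
    rw [div_mul_div_comm, norm_div, norm_div, norm_mul (n.factorial : ℂ), norm_mul (n.factorial : ℂ)]
    gcongr
    exact hb N n

lemma GammaSeq_eq_div_poch (z : ℂ) (n : ℕ) :
    Complex.GammaSeq z n = (n : ℂ) ^ z * n.factorial / poch z (n + 1) := by
  have : ∀ m : ℕ, poch z m = ∏ j ∈ Finset.range m, (z + j) := fun m => by
    induction m with
    | zero => simp
    | succ m ih => rw [poch_succ, ih, Finset.prod_range_succ]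
  rw [Complex.GammaSeq, this]

/-- Valid for every `z`: at a pole of `Γ` the sequence is eventually `0`, and so is the limit, with
`Γ z = 0` and `0⁻¹ = 0`. -/
lemma tendsto_inv_GammaSeq (z : ℂ) :
    Tendsto (fun n => (Complex.GammaSeq z n)⁻¹) atTop (𝓝 (Complex.Gamma z)⁻¹) := by
  by_cases hz : Complex.Gamma z = 0
  · obtain ⟨m, rfl⟩ := (Complex.Gamma_eq_zero_iff z).1 hz
    refine tendsto_const_nhds.congr' ?_
    filter_upwards [eventually_ge_atTop m] with n hn
    have h0 : poch (-(m : ℂ)) (n + 1) = 0 := by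
      obtain ⟨k, rfl⟩ := Nat.exists_eq_add_of_le hn
      rw [add_right_comm, poch_add, poch_succ]
      simp
    rw [hz, GammaSeq_eq_div_poch, h0, div_zero]
  · exact (Complex.GammaSeq_tendsto_Gamma z).inv₀ hz

/-- **Gauss's theorem** in regularised form, valid for every `c`:
`₂F₁(a, b; c; 1) / Γ(c) = Γ(c - a - b) / (Γ(c - a) Γ(c - b))`. -/
theorem tsum_gaussTerm {a b c : ℂ} (h : 0 < (c - a - b).re) :
    ∑' n, gaussTerm a b c n =
      Complex.Gamma (c - a - b) * (Complex.Gamma (c - a))⁻¹ * (Complex.Gamma (c - b))⁻¹ := by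
  -- Both sides satisfy the contiguous relation, which reduces the claim to `0 < Re c`.
  obtain ⟨M, hM⟩ := exists_nat_gt (-c.re)
  induction M generalizing c with
  | succ M ih =>
    have h1 := tsum_gaussTerm_add_one h
    have hne : c - a - b ≠ 0 := by rintro h0; rw [h0] at h; simp at h
    rw [ih (c := c + 1) (by simp at h ⊢; linarith) (by push_cast at hM; simp; linarith)] at h1
    rw [Complex.one_div_Gamma_eq_self_mul_one_div_Gamma_add_one (c - a),
      Complex.one_div_Gamma_eq_self_mul_one_div_Gamma_add_one (c - b)]
    rw [show c + 1 - a - b = c - a - b + 1 by ring, show c + 1 - a = c - a + 1 by ring,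
      show c + 1 - b = c - b + 1 by ring, Complex.Gamma_add_one _ hne] at h1
    apply mul_left_cancel₀ hne
    rw [h1]
    ring
  | zero =>
    have hc : 0 < c.re := by simpa using hM
    have hG := Complex.Gamma_ne_zero_of_re_pos hc
    have hev : ∀ N : ℕ, N ≠ 0 → Complex.GammaSeq (c - a - b) N * Complex.GammaSeq c N *
        (Complex.GammaSeq (c - a) N)⁻¹ * (Complex.GammaSeq (c - b) N)⁻¹ * (Complex.Gamma c)⁻¹ *
        (∑' n : ℕ, poch a n * poch b n / (n.factorial * poch (c + (N + 1 : ℕ)) n)) =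
        ∑' n, gaussTerm a b c n := by
      intro N hN
      have h1 := tsum_gaussTerm_add_nat h (N + 1)
      have h2 : ∑' n, gaussTerm a b (c + (N + 1 : ℕ)) n = (poch c (N + 1) * Complex.Gamma c)⁻¹ *
          ∑' n : ℕ, poch a n * poch b n / (n.factorial * poch (c + (N + 1 : ℕ)) n) := by
        rw [← tsum_mul_left]
        refine tsum_congr fun n => ?_
        rw [gaussTerm, Gamma_add_nat_eq_poch_mul (ne_neg_natCast_of_re_pos (by simp; positivity)),
          Gamma_add_nat_eq_poch_mul (ne_neg_natCast_of_re_pos hc), mul_inv, div_eq_mul_inv,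
          div_eq_mul_inv, mul_inv]
        ring
      have hp := poch_ne_zero_of_re_pos h (N + 1)
      have hpc := poch_ne_zero_of_re_pos hc (N + 1)
      have hf : (N.factorial : ℂ) ≠ 0 := by exact_mod_cast N.factorial_ne_zero
      have hN0 : (N : ℂ) ≠ 0 := by exact_mod_cast hN
      have hpow : (N : ℂ) ^ (c - a - b) * (N : ℂ) ^ c = (N : ℂ) ^ (c - a) * (N : ℂ) ^ (c - b) := by
        rw [← Complex.cpow_add _ _ hN0, ← Complex.cpow_add _ _ hN0]
        congr 1
        ring
      have hq1 : (N : ℂ) ^ (c - a) ≠ 0 := by simp [Complex.cpow_eq_zero_iff, hN0]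
      have hq2 : (N : ℂ) ^ (c - b) ≠ 0 := by simp [Complex.cpow_eq_zero_iff, hN0]
      apply mul_left_cancel₀ hp
      rw [h1, h2]
      simp only [GammaSeq_eq_div_poch, inv_div]
      field_simp
      linear_combination (poch (c - a) (N + 1) * poch (c - b) (N + 1) *
        ∑' n : ℕ, poch a n * poch b n / (n.factorial * poch (c + (N + 1 : ℕ)) n)) * hpow
    have hlim := (((((Complex.GammaSeq_tendsto_Gamma (c - a - b)).mul
      (Complex.GammaSeq_tendsto_Gamma c)).mul (tendsto_inv_GammaSeq (c - a))).mul
      (tendsto_inv_GammaSeq (c - b))).mul_const (Complex.Gamma c)⁻¹).mul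
      ((tendsto_tsum_poch_div_add_nat hc h).comp (tendsto_add_atTop_nat 1))
    have hlim' : Tendsto (fun _ : ℕ => ∑' n, gaussTerm a b c n) atTop _ :=
      hlim.congr' ((eventually_ne_atTop 0).mono fun N hN => hev N hN)
    rw [tendsto_nhds_unique tendsto_const_nhds hlim']
    field_simp

/-! ### The double series of the third Appell function -/

lemma summable_rpow_mul_pow (p : ℝ) {r : ℝ} (hr0 : 0 ≤ r) (hr : r < 1) :
    Summable fun n : ℕ => ((n : ℝ) + 1) ^ p * r ^ n := by
  obtain ⟨k, hk⟩ := exists_nat_ge p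
  set q := max r (1 / 2) with hq
  have hq0 : 0 < q := lt_max_of_lt_right (by norm_num)
  have hq1 : q < 1 := max_lt hr (by norm_num)
  have h := (summable_nat_add_iff 1).2
    (summable_pow_mul_geometric_of_norm_lt_one k (r := q) (by rwa [Real.norm_of_nonneg hq0.le]))
  refine Summable.of_nonneg_of_le (fun n => by positivity) (fun n => ?_) (h.mul_left q⁻¹)
  have h1 : ((n : ℝ) + 1) ^ p ≤ ((n : ℝ) + 1) ^ k := by
    rw [← Real.rpow_natCast]
    exact Real.rpow_le_rpow_of_exponent_le (by linarith [(n.cast_nonneg : (0 : ℝ) ≤ n)]) hk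
  have h2 : r ^ n ≤ q ^ n := pow_le_pow_left₀ hr0 (le_max_left _ _) n
  calc ((n : ℝ) + 1) ^ p * r ^ n ≤ ((n : ℝ) + 1) ^ k * q ^ n := by gcongr
    _ = _ := by push_cast; field_simp; ring

/-- A double sequence of polynomial growth is summable against a geometric double sequence. -/
lemma summable_norm_mul_pow_mul_pow {T : ℕ × ℕ → ℂ} {C p q r s : ℝ}
    (hT : ∀ k, ‖T k‖ ≤ C * (((k.1 : ℝ) + 1) ^ p * ((k.2 : ℝ) + 1) ^ q))
    (hr0 : 0 ≤ r) (hr : r < 1) (hs0 : 0 ≤ s) (hs : s < 1) :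
    Summable fun k : ℕ × ℕ => ‖T k‖ * r ^ k.1 * s ^ k.2 := by
  have h := ((summable_rpow_mul_pow p hr0 hr).mul_of_nonneg (summable_rpow_mul_pow q hs0 hs)
    (fun _ => by positivity) (fun _ => by positivity)).mul_left C
  refine Summable.of_nonneg_of_le (fun k => by positivity) (fun k => ?_) h
  calc ‖T k‖ * r ^ k.1 * s ^ k.2 ≤ C * (((k.1 : ℝ) + 1) ^ p * ((k.2 : ℝ) + 1) ^ q) * r ^ k.1 * s ^ k.2 := by
        gcongr
        exact hT k
    _ = _ := by ring

/-- The coefficient of `u ^ m * v ^ n` in `F₃(a, a', b, b'; c; u, v)`. -/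
noncomputable def appellF3Coeff (a a' b b' c : ℂ) (k : ℕ × ℕ) : ℂ :=
  poch a k.1 * poch a' k.2 * poch b k.1 * poch b' k.2 /
    (poch c (k.1 + k.2) * (k.1.factorial : ℂ) * (k.2.factorial : ℂ))

/-- The coefficient of `u ^ m * w ^ n` in `(1 - v) ^ a' * F₃(a, a', b, b'; c; u, v)`, where
`w = v / (v - 1)`. -/
noncomputable def pfaffCoeff (a a' b b' c : ℂ) (k : ℕ × ℕ) : ℂ :=
  poch a k.1 * poch b k.1 * poch a' k.2 * poch (c - b' + k.1) k.2 /
    (poch c (k.1 + k.2) * (k.1.factorial : ℂ) * (k.2.factorial : ℂ))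

lemma exists_norm_pfaffCoeff_le (a a' b b' c : ℂ) (hc : 0 < c.re) :
    ∃ C : ℝ, 0 < C ∧ ∀ k, ‖pfaffCoeff a a' b b' c k‖ ≤
      C * (((k.1 : ℝ) + 1) ^ ((a + b - c).re - 1) * ((k.2 : ℝ) + 1) ^ (a'.re - 1) *
        (((k.1 : ℝ) + k.2 + 1) / (k.1 + 1)) ^ (-b'.re)) := by
  obtain ⟨A, hA, ha⟩ := exists_norm_poch_div_factorial_le a
  obtain ⟨A', hA', ha'⟩ := exists_norm_poch_div_factorial_le a'
  obtain ⟨B, hB, hb⟩ := exists_norm_poch_div_poch_zero_le b c hc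
  obtain ⟨D, hD, hd⟩ := exists_norm_poch_div_poch_le (c - b') c hc
  refine ⟨A * A' * B * D, by positivity, fun ⟨m, n⟩ => ?_⟩
  have e : pfaffCoeff a a' b b' c (m, n) = poch a m / m.factorial * (poch b m / poch c m) *
      (poch a' n / n.factorial) * (poch (c - b' + m) n / poch (c + m) n) := by
    simp only [pfaffCoeff, poch_add, div_mul_div_comm]
    congr 1
    ring
  rw [e, norm_mul, norm_mul, norm_mul]
  have hm : (0 : ℝ) < (m : ℝ) + 1 := by positivity
  calc _ ≤ A * ((m : ℝ) + 1) ^ (a.re - 1) * (B * ((m : ℝ) + 1) ^ (b - c).re) *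
        (A' * ((n : ℝ) + 1) ^ (a'.re - 1)) *
        (D * (((m : ℝ) + n + 1) / (m + 1)) ^ (c - b' - c).re) := by
        gcongr
        exacts [ha m, hb m, ha' n, hd m n]
    _ = A * A' * B * D * ((((m : ℝ) + 1) ^ (a.re - 1) * ((m : ℝ) + 1) ^ (b - c).re) *
        ((n : ℝ) + 1) ^ (a'.re - 1) * (((m : ℝ) + n + 1) / (m + 1)) ^ (c - b' - c).re) := by ring
    _ = _ := by
      rw [← Real.rpow_add hm, show a.re - 1 + (b - c).re = (a + b - c).re - 1 by simp; ring,
        show (c - b' - c).re = -b'.re by simp]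

lemma summable_norm_pfaffCoeff_mul_pow (a a' b b' c : ℂ) (hc : 0 < c.re) {r s : ℝ}
    (hr0 : 0 ≤ r) (hr : r < 1) (hs0 : 0 ≤ s) (hs : s < 1) :
    Summable fun k : ℕ × ℕ => ‖pfaffCoeff a a' b b' c k‖ * r ^ k.1 * s ^ k.2 := by
  obtain ⟨C, hC, h⟩ := exists_norm_pfaffCoeff_le a a' b b' c hc
  refine summable_norm_mul_pow_mul_pow (C := C) (p := (a + b - c).re - 1)
    (q := a'.re - 1 + |b'.re|) (fun k => (h k).trans ?_) hr0 hr hs0 hs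
  have hm : (0 : ℝ) ≤ k.1 := k.1.cast_nonneg
  have hn : (0 : ℝ) ≤ k.2 := k.2.cast_nonneg
  rw [Real.rpow_add (by positivity), mul_assoc]
  gcongr
  calc (((k.1 : ℝ) + k.2 + 1) / (k.1 + 1)) ^ (-b'.re)
      ≤ (((k.1 : ℝ) + k.2 + 1) / (k.1 + 1)) ^ |b'.re| := by
        refine Real.rpow_le_rpow_of_exponent_le ?_ (neg_le_abs _)
        rw [le_div_iff₀ (by positivity)]
        linarith
    _ ≤ _ := by
        refine Real.rpow_le_rpow (by positivity) ?_ (abs_nonneg _)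
        rw [div_le_iff₀ (by positivity)]
        nlinarith

lemma summable_norm_appellF3Coeff_mul_pow (a a' b b' c : ℂ) (hc : 0 < c.re) {r s : ℝ}
    (hr0 : 0 ≤ r) (hr : r < 1) (hs0 : 0 ≤ s) (hs : s < 1) :
    Summable fun k : ℕ × ℕ => ‖appellF3Coeff a a' b b' c k‖ * r ^ k.1 * s ^ k.2 := by
  obtain ⟨A, hA, ha⟩ := exists_norm_poch_div_factorial_le a
  obtain ⟨A', hA', ha'⟩ := exists_norm_poch_div_factorial_le a'
  obtain ⟨B, hB, hb⟩ := exists_norm_poch_div_poch_zero_le b c hc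
  obtain ⟨D, hD, hd⟩ := exists_norm_poch_div_poch_zero_le b' (c.re : ℂ) (by simpa using hc)
  refine summable_norm_mul_pow_mul_pow (C := A * A' * B * D) (p := a.re - 1 + (b - c).re)
    (q := a'.re - 1 + (b' - (c.re : ℂ)).re) (fun ⟨m, n⟩ => ?_) hr0 hr hs0 hs
  have e : appellF3Coeff a a' b b' c (m, n) = poch a m / m.factorial * (poch b m / poch c m) *
      (poch a' n / n.factorial) * (poch b' n / poch (c + m) n) := by
    simp only [appellF3Coeff, poch_add, div_mul_div_comm]
    congr 1 <;> ring
  have hd' : ‖poch b' n / poch (c + m) n‖ ≤ D * ((n : ℝ) + 1) ^ (b' - (c.re : ℂ)).re := by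
    refine le_trans ?_ (hd n)
    have : 0 < ‖poch (c.re : ℂ) n‖ := norm_pos_iff.2 (poch_ne_zero_of_re_pos (by simpa using hc) n)
    rw [norm_div, norm_div]
    gcongr
    exact norm_poch_re_le hc.le (by simp) n
  rw [e, norm_mul, norm_mul, norm_mul, Real.rpow_add (by positivity), Real.rpow_add (by positivity)]
  calc _ ≤ A * ((m : ℝ) + 1) ^ (a.re - 1) * (B * ((m : ℝ) + 1) ^ (b - c).re) *
        (A' * ((n : ℝ) + 1) ^ (a'.re - 1)) * (D * ((n : ℝ) + 1) ^ (b' - (c.re : ℂ)).re) := by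
        gcongr
        exacts [ha m, hb m, ha' n]
    _ = _ := by ring

lemma summable_mul_pow_of_norm_le {T : ℕ × ℕ → ℂ} {r s : ℝ}
    (hT : Summable fun k : ℕ × ℕ => ‖T k‖ * r ^ k.1 * s ^ k.2) {u v : ℂ} (hu : ‖u‖ ≤ r)
    (hv : ‖v‖ ≤ s) : Summable fun k : ℕ × ℕ => T k * u ^ k.1 * v ^ k.2 := by
  have hr0 := (norm_nonneg u).trans hu
  refine Summable.of_norm_bounded hT fun k => ?_
  rw [norm_mul, norm_mul, norm_pow, norm_pow]
  gcongr

lemma summable_appellF3Coeff (a a' b b' c : ℂ) (hc : 0 < c.re) {u v : ℂ} (hu : ‖u‖ < 1)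
    (hv : ‖v‖ < 1) : Summable fun k : ℕ × ℕ => appellF3Coeff a a' b b' c k * u ^ k.1 * v ^ k.2 :=
  summable_mul_pow_of_norm_le (summable_norm_appellF3Coeff_mul_pow a a' b b' c hc
    (norm_nonneg u) hu (norm_nonneg v) hv) le_rfl le_rfl

lemma summable_pfaffCoeff (a a' b b' c : ℂ) (hc : 0 < c.re) {u v : ℂ} (hu : ‖u‖ < 1)
    (hv : ‖v‖ < 1) : Summable fun k : ℕ × ℕ => pfaffCoeff a a' b b' c k * u ^ k.1 * v ^ k.2 :=
  summable_mul_pow_of_norm_le (summable_norm_pfaffCoeff_mul_pow a a' b b' c hc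
    (norm_nonneg u) hu (norm_nonneg v) hv) le_rfl le_rfl

/-! ### Pfaff's transformation -/

lemma hasSum_binomial (a : ℂ) {z : ℂ} (hz : ‖z‖ < 1) :
    HasSum (fun k : ℕ => poch a k / k.factorial * z ^ k) ((1 - z) ^ (-a)) := by
  have h := (Complex.one_div_one_sub_cpow_hasFPowerSeriesOnBall_zero a).hasSum (y := z) (by
    rw [Metric.mem_eball, edist_zero_right, enorm_eq_nnnorm]
    exact_mod_cast hz)
  rw [zero_add, one_div, ← Complex.cpow_neg] at h
  have key : ∀ k : ℕ, (FormalMultilinearSeries.ofScalars ℂ (fun n : ℕ => Ring.choose (a + n - 1) n) k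
      fun _ => z) = poch a k / k.factorial * z ^ k := fun k => by
    have h1 := Ring.factorial_nsmul_multichoose_eq_ascPochhammer a k
    rw [Ring.multichoose_eq, Polynomial.ascPochhammer_smeval_eq_eval, nsmul_eq_mul] at h1
    have hk : (k.factorial : ℂ) ≠ 0 := by exact_mod_cast k.factorial_ne_zero
    rw [FormalMultilinearSeries.ofScalars_apply_eq, poch, ← h1, smul_eq_mul,
      mul_div_cancel_left₀ _ hk]
  simpa only [key] using h

/-- **Pfaff's transformation** of `₂F₁`, near the origin. -/
lemma tsum_pfaff (a b C : ℂ) (hC : 0 < C.re) {V : ℂ} (hV : ‖V‖ < 1 / 2) :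
    ∑' n : ℕ, poch a n * poch b n / (poch C n * n.factorial) * V ^ n =
      (1 - V) ^ (-a) * ∑' n : ℕ, poch a n * poch (C - b) n / (poch C n * n.factorial) *
        (V / (V - 1)) ^ n := by
  have hCn := ne_neg_natCast_of_re_pos hC
  have hV1 : (1 : ℂ) - V ≠ 0 := by
    intro h
    rw [← sub_eq_zero.1 h] at hV
    norm_num at hV
  set G : ℕ × ℕ → ℂ := fun k => poch a k.1 * poch (C - b) k.1 / (poch C k.1 * k.1.factorial) *
    (-V) ^ k.1 * (poch (a + k.1) k.2 / k.2.factorial * V ^ k.2) with hG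
  have hGe : ∀ n k : ℕ, G (n, k) = poch a (n + k) / (n + k).factorial * V ^ (n + k) *
      ((-1) ^ n * ((n + k).choose n : ℂ) * (poch (C - b) n / poch C n)) := by
    intro n k
    have h1 : ((n + k).choose n : ℂ) * n.factorial * k.factorial = (n + k).factorial := by
      have := Nat.choose_mul_factorial_mul_factorial (Nat.le_add_right n k)
      rw [Nat.add_sub_cancel_left] at this
      exact_mod_cast this
    have hn : (n.factorial : ℂ) ≠ 0 := by exact_mod_cast n.factorial_ne_zero
    have hk : (k.factorial : ℂ) ≠ 0 := by exact_mod_cast k.factorial_ne_zero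
    have hnk : ((n + k).factorial : ℂ) ≠ 0 := by exact_mod_cast (n + k).factorial_ne_zero
    have hp := poch_ne_zero hCn n
    have h2 : ((n + k).choose n : ℂ) = (n + k).factorial / (n.factorial * k.factorial) := by
      rw [← h1]; field_simp
    simp only [hG]
    rw [h2, poch_add, neg_pow, pow_add]
    field_simp
  have hsum : Summable G := by
    obtain ⟨A, hA, ha⟩ := exists_norm_poch_div_factorial_le a
    obtain ⟨B, hB, hb⟩ := exists_norm_poch_div_poch_zero_le (C - b) C hC
    set p := |a.re - 1| with hp
    have h2V : 2 * ‖V‖ < 1 := by linarith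
    have h := (((summable_rpow_mul_pow (p + (C - b - C).re) (by positivity) h2V).mul_of_nonneg
      (summable_rpow_mul_pow p (by positivity) h2V)
      (fun _ => by positivity) (fun _ => by positivity)).mul_left (A * B))
    refine Summable.of_norm_bounded h fun ⟨n, k⟩ => ?_
    rw [hGe, norm_mul, norm_mul, norm_mul, norm_mul, norm_pow, norm_pow, norm_neg, norm_one, one_pow,
      one_mul, Complex.norm_natCast]
    have hch : ((n + k).choose n : ℝ) ≤ 2 ^ (n + k) := by exact_mod_cast Nat.choose_le_two_pow _ _
    have h1 : ‖poch a (n + k) / (n + k).factorial‖ ≤ A * (((n : ℝ) + 1) ^ p * ((k : ℝ) + 1) ^ p) := by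
      refine (ha (n + k)).trans ?_
      have hn : (0 : ℝ) ≤ n := n.cast_nonneg
      have hk : (0 : ℝ) ≤ k := k.cast_nonneg
      gcongr
      rw [← Real.mul_rpow (by positivity) (by positivity)]
      push_cast
      refine (Real.rpow_le_rpow_of_exponent_le (by linarith) (le_abs_self _)).trans ?_
      refine Real.rpow_le_rpow (by positivity) ?_ (abs_nonneg _)
      nlinarith
    calc _ ≤ A * (((n : ℝ) + 1) ^ p * ((k : ℝ) + 1) ^ p) * ‖V‖ ^ (n + k) *
          (2 ^ (n + k) * (B * ((n : ℝ) + 1) ^ (C - b - C).re)) := by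
          gcongr
          exact hb n
      _ = _ := by
          simp only
          rw [Real.rpow_add (by positivity), mul_pow, mul_pow, pow_add, pow_add]
          ring
  have hR : ∑' k, G k = (1 - V) ^ (-a) * ∑' n : ℕ, poch a n * poch (C - b) n /
      (poch C n * n.factorial) * (V / (V - 1)) ^ n := by
    rw [hsum.tsum_prod, ← tsum_mul_left]
    refine tsum_congr fun n => ?_
    simp only [hG]
    rw [tsum_mul_left, (hasSum_binomial (a + n) (by linarith)).tsum_eq, neg_add, ← sub_eq_add_neg,
      Complex.cpow_sub _ _ hV1, Complex.cpow_natCast, ← neg_sub 1 V, div_neg, ← neg_div, div_pow]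
    ring
  have hsig : Summable fun x : (N : ℕ) × Finset.HasAntidiagonal.antidiagonal N =>
      G (Finset.HasAntidiagonal.sigmaAntidiagonalEquivProd x) :=
    (Finset.HasAntidiagonal.sigmaAntidiagonalEquivProd (A := ℕ)).summable_iff.2 hsum
  rw [← hR, ← Finset.HasAntidiagonal.sigmaAntidiagonalEquivProd.tsum_eq,
    hsig.tsum_sigma' (fun _ => (hasSum_fintype _).summable)]
  refine tsum_congr fun N => ?_
  rw [tsum_fintype]
  simp only [Finset.HasAntidiagonal.sigmaAntidiagonalEquivProd_apply]
  rw [Finset.sum_coe_sort (Finset.HasAntidiagonal.antidiagonal N) G,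
    Finset.Nat.sum_antidiagonal_eq_sum_range_succ_mk]
  have : ∀ n ∈ Finset.range (N + 1), G (n, N - n) = poch a N / N.factorial * V ^ N *
      ((-1) ^ n * (N.choose n : ℂ) * (poch (C - b) n / poch C n)) := by
    intro n hn
    rw [hGe, Nat.add_sub_cancel' (by simpa [Nat.lt_succ_iff] using hn)]
  rw [Finset.sum_congr rfl this, ← Finset.mul_sum, sum_neg_one_pow_choose_poch N _ C hCn,
    sub_sub_cancel]
  have hp := poch_ne_zero hCn N
  have hN : (N.factorial : ℂ) ≠ 0 := by exact_mod_cast N.factorial_ne_zero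
  field_simp

lemma appellF3Series_eq_tsum (a a' b b' c u v : ℂ) :
    appellF3Series a a' b b' c u v =
      ∑' k : ℕ × ℕ, appellF3Coeff a a' b b' c k * u ^ k.1 * v ^ k.2 := rfl

/-- Pfaff's transformation in the second variable of `F₃`, near the origin. -/
lemma appellF3Series_eq_pfaff (a a' b b' c : ℂ) (hc : 0 < c.re) {u v : ℂ} (hu : ‖u‖ < 1)
    (hv : ‖v‖ < 1 / 3) :
    appellF3Series a a' b b' c u v =
      (1 - v) ^ (-a') * ∑' k : ℕ × ℕ, pfaffCoeff a a' b b' c k * u ^ k.1 * (v / (v - 1)) ^ k.2 := by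
  have hw : ‖v / (v - 1)‖ < 1 := by
    have h1 : 1 - ‖v‖ ≤ ‖v - 1‖ := by
      have := norm_sub_norm_le (1 : ℂ) v
      rwa [norm_one, norm_sub_rev] at this
    rw [norm_div, div_lt_one (by linarith)]
    linarith
  have s1 := summable_appellF3Coeff a a' b b' c hc hu (v := v) (by linarith)
  have s2 := summable_pfaffCoeff a a' b b' c hc hu hw
  rw [appellF3Series_eq_tsum, s1.tsum_prod, s2.tsum_prod, ← tsum_mul_left]
  refine tsum_congr fun m => ?_
  have h := tsum_pfaff a' b' (c + m) (by simp; positivity) (V := v) (by linarith)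
  have e1 : ∀ n : ℕ, appellF3Coeff a a' b b' c (m, n) * u ^ m * v ^ n =
      poch a m * poch b m / (poch c m * m.factorial) * u ^ m *
        (poch a' n * poch b' n / (poch (c + m) n * n.factorial) * v ^ n) := fun n => by
    simp only [appellF3Coeff, poch_add, div_eq_mul_inv, mul_inv]
    ring
  have e2 : ∀ n : ℕ, pfaffCoeff a a' b b' c (m, n) * u ^ m * (v / (v - 1)) ^ n =
      poch a m * poch b m / (poch c m * m.factorial) * u ^ m *
        (poch a' n * poch (c + m - b') n / (poch (c + m) n * n.factorial) * (v / (v - 1)) ^ n) :=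
    fun n => by
      rw [show c + m - b' = c - b' + m by ring]
      simp only [pfaffCoeff, poch_add, div_eq_mul_inv, mul_inv]
      ring
  simp only [e1, e2]
  rw [tsum_mul_left, h, tsum_mul_left]
  ring

/-- The contiguous relation of `F₃` which raises its parameter `a'`. -/
lemma appellF3Series_contiguous (a a' b b' c : ℂ) (hc : 0 < c.re) {u v : ℂ} (hu : ‖u‖ < 1)
    (hv : ‖v‖ < 1) :
    appellF3Series a a' b b' c u v = appellF3Series a (a' + 1) b b' c u v -
      b' / c * v * appellF3Series a (a' + 1) b (b' + 1) (c + 1) u v := by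
  have s0 := summable_appellF3Coeff a a' b b' c hc hu hv
  have s1 := summable_appellF3Coeff a (a' + 1) b b' c hc hu hv
  have s2 := summable_appellF3Coeff a (a' + 1) b (b' + 1) (c + 1) (by simp; linarith) hu hv
  have hc0 : c ≠ 0 := by rintro rfl; simp at hc
  have hD : ∀ m n : ℕ, appellF3Coeff a (a' + 1) b b' c (m, n + 1) * u ^ m * v ^ (n + 1) -
      appellF3Coeff a a' b b' c (m, n + 1) * u ^ m * v ^ (n + 1) =
      b' / c * v * (appellF3Coeff a (a' + 1) b (b' + 1) (c + 1) (m, n) * u ^ m * v ^ n) := by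
    intro m n
    have h1 : poch (c + 1) (m + n) ≠ 0 := poch_ne_zero_of_re_pos (by simp; linarith) _
    have hm : (m.factorial : ℂ) ≠ 0 := by exact_mod_cast m.factorial_ne_zero
    have hn : (n.factorial : ℂ) ≠ 0 := by exact_mod_cast n.factorial_ne_zero
    have hn1 : (n : ℂ) + 1 ≠ 0 := by exact_mod_cast n.succ_ne_zero
    simp only [appellF3Coeff, ← add_assoc]
    rw [poch_succ_left c, poch_succ_left b', poch_succ_left a', poch_succ (a' + 1), Nat.factorial_succ]
    push_cast
    field_simp
    ring
  rw [eq_sub_iff_add_eq, ← eq_sub_iff_add_eq']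
  simp only [appellF3Series_eq_tsum]
  rw [← s1.tsum_sub s0, (s1.sub s0).tsum_prod, s2.tsum_prod, ← tsum_mul_left]
  refine tsum_congr fun m => ?_
  rw [((s1.sub s0).prod_factor m).tsum_eq_zero_add, ← tsum_mul_left]
  simp only [hD]
  simp [appellF3Coeff]

/-! ### Analytic continuation of the third Appell function -/

/-- A star-shaped domain to which `s ↦ F₃(s u, s v)` continues holomorphically by means of Pfaff's
transformation in the second variable. -/
def pfaffDomain (u v : ℂ) (r : ℝ) : Set ℂ := {s | ‖s * u‖ < r ∧ ‖s * v‖ < r * ‖1 - s * v‖}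

lemma isOpen_pfaffDomain (u v : ℂ) (r : ℝ) : IsOpen (pfaffDomain u v r) := by
  have h1 : IsOpen {s : ℂ | ‖s * u‖ < r} := isOpen_lt (by fun_prop) (by fun_prop)
  have h2 : IsOpen {s : ℂ | ‖s * v‖ < r * ‖1 - s * v‖} := isOpen_lt (by fun_prop) (by fun_prop)
  exact h1.inter h2

lemma starConvex_pfaffDomain (u v : ℂ) {r : ℝ} (hr0 : 0 < r) (hr : r < 1) :
    StarConvex ℝ 0 (pfaffDomain u v r) := by
  rw [starConvex_zero_iff]
  rintro s ⟨h1, h2⟩ t ht0 ht1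
  have hn : ∀ w : ℂ, ‖t • s * w‖ = t * ‖s * w‖ := fun w => by
    rw [smul_mul_assoc, norm_smul, Real.norm_of_nonneg ht0]
  refine ⟨?_, ?_⟩
  · rw [hn]
    nlinarith [norm_nonneg (s * u)]
  · -- `‖z‖ < r ‖1 - z‖` is a quadratic inequality, convex along rays since `r < 1`.
    rw [hn, smul_mul_assoc]
    set z := s * v
    have hsq : ∀ q : ℝ, ‖1 - q • z‖ ^ 2 = 1 - 2 * q * z.re + q ^ 2 * ‖z‖ ^ 2 := fun q => by
      rw [← Complex.normSq_eq_norm_sq, ← Complex.normSq_eq_norm_sq, Complex.normSq_apply,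
        Complex.normSq_apply]
      simp
      ring
    have h3 : ‖z‖ ^ 2 < r ^ 2 * (1 - 2 * z.re + ‖z‖ ^ 2) := by
      have := hsq 1
      simp only [one_smul, mul_one, one_pow, one_mul] at this
      rw [← this, ← mul_pow]
      exact pow_lt_pow_left₀ h2 (norm_nonneg _) two_ne_zero
    refine lt_of_pow_lt_pow_left₀ 2 (by positivity) ?_
    rw [mul_pow, mul_pow, hsq]
    have hA : 0 ≤ (1 - r ^ 2) * ‖z‖ ^ 2 := mul_nonneg (by nlinarith) (sq_nonneg _)
    rcases ht0.eq_or_lt with rfl | ht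
    · simp; positivity
    · nlinarith [mul_lt_mul_of_pos_left h3 ht, mul_nonneg (mul_nonneg ht.le (sub_nonneg.2 ht1)) hA,
        mul_nonneg (sub_nonneg.2 ht1) (sq_nonneg r)]

lemma one_sub_mem_slitPlane {z : ℂ} {r : ℝ} (hr : r < 1) (h : ‖z‖ < r * ‖1 - z‖) :
    1 - z ∈ Complex.slitPlane := by
  left
  have h1 : ‖z‖ < ‖1 - z‖ := by nlinarith [norm_nonneg (1 - z)]
  have h2 := pow_lt_pow_left₀ h1 (norm_nonneg _) two_ne_zero
  rw [← Complex.normSq_eq_norm_sq, ← Complex.normSq_eq_norm_sq, Complex.normSq_apply,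
    Complex.normSq_apply] at h2
  simp at h2 ⊢
  nlinarith

/-- The continuation of `s ↦ F₃(s u, s v)` to `pfaffDomain u v r`. -/
noncomputable def pfaffContinuation (a a' b b' c u v s : ℂ) : ℂ :=
  (1 - s * v) ^ (-a') *
    ∑' k : ℕ × ℕ, pfaffCoeff a a' b b' c k * (s * u) ^ k.1 * (s * v / (s * v - 1)) ^ k.2

lemma differentiableOn_pfaffContinuation (a a' b b' c u v : ℂ) (hc : 0 < c.re) {r : ℝ}
    (hr0 : 0 < r) (hr : r < 1) :
    DifferentiableOn ℂ (pfaffContinuation a a' b b' c u v) (pfaffDomain u v r) := by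
  have hne : ∀ s ∈ pfaffDomain u v r, 1 - s * v ≠ 0 := fun s hs =>
    Complex.slitPlane_ne_zero (one_sub_mem_slitPlane hr hs.2)
  have hne' : ∀ s ∈ pfaffDomain u v r, s * v - 1 ≠ 0 := fun s hs h =>
    hne s hs (by linear_combination -h)
  refine DifferentiableOn.mul (fun s hs => ?_) ?_
  · have hd : DifferentiableAt ℂ (fun s => 1 - s * v) s := by fun_prop
    exact (hd.cpow (differentiableAt_const _)
      (one_sub_mem_slitPlane hr hs.2)).differentiableWithinAt
  · refine Complex.differentiableOn_tsum_of_summable_norm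
      (summable_norm_pfaffCoeff_mul_pow a a' b b' c hc hr0.le hr hr0.le hr) (fun k s hs => ?_)
      (isOpen_pfaffDomain u v r) fun k s hs => ?_
    · have h := hne' s hs
      fun_prop (disch := assumption)
    · have h : 0 < ‖1 - s * v‖ := norm_pos_iff.2 (hne s hs)
      have h' : ‖s * v / (s * v - 1)‖ ≤ r := by
        rw [norm_div, norm_sub_rev, div_le_iff₀ h]
        exact hs.2.le
      rw [norm_mul, norm_mul, norm_pow, norm_pow]
      gcongr
      exact hs.1.le

lemma eventually_norm_mul_lt (u : ℂ) {ε : ℝ} (hε : 0 < ε) : ∀ᶠ s : ℂ in 𝓝 0, ‖s * u‖ < ε := by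
  have : Tendsto (fun s : ℂ => ‖s * u‖) (𝓝 0) (𝓝 0) := by
    have h : Continuous fun s : ℂ => ‖s * u‖ := by fun_prop
    simpa using h.tendsto 0
  exact this.eventually_lt_const hε

lemma isStarContinuation_pfaff (a a' b b' c u v : ℂ) (hc : 0 < c.re) {r : ℝ}
    (hr0 : 0 < r) (hr : r < 1) :
    IsStarContinuation (fun s => appellF3Series a a' b b' c (s * u) (s * v))
      (pfaffContinuation a a' b b' c u v) (pfaffDomain u v r) := by
  refine ⟨isOpen_pfaffDomain u v r, starConvex_pfaffDomain u v hr0 hr,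
    differentiableOn_pfaffContinuation a a' b b' c u v hc hr0 hr, ?_⟩
  filter_upwards [eventually_norm_mul_lt u one_pos,
    eventually_norm_mul_lt v (show (0 : ℝ) < 1 / 3 by norm_num)] with s h1 h2
  exact appellF3Series_eq_pfaff a a' b b' c hc h1 h2

/-- The value of `F₃` as a Pfaff-transformed double series. -/
lemma appellF3_eq_pfaffContinuation (a a' b b' c u v : ℂ) (hc : 0 < c.re) {r : ℝ}
    (hr : r < 1) (h : 1 ∈ pfaffDomain u v r) :
    appellF3 a a' b b' c u v = pfaffContinuation a a' b b' c u v 1 :=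
  starContinuation_eq
    (isStarContinuation_pfaff a a' b b' c u v hc ((norm_nonneg _).trans_lt h.1) hr) h

lemma appellF3_contiguous (a a' b b' c u v : ℂ) (hc : 0 < c.re) {r : ℝ}
    (hr : r < 1) (h : 1 ∈ pfaffDomain u v r) :
    appellF3 a a' b b' c u v = appellF3 a (a' + 1) b b' c u v -
      b' / c * v * appellF3 a (a' + 1) b (b' + 1) (c + 1) u v := by
  have hc1 : 0 < (c + 1).re := by simp; linarith
  have hr0 : 0 < r := (norm_nonneg _).trans_lt h.1
  have hcont : IsStarContinuation (fun s => appellF3Series a a' b b' c (s * u) (s * v))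
      (fun s => pfaffContinuation a (a' + 1) b b' c u v s -
        b' / c * (s * v) * pfaffContinuation a (a' + 1) b (b' + 1) (c + 1) u v s)
      (pfaffDomain u v r) := by
    refine ⟨isOpen_pfaffDomain u v r, starConvex_pfaffDomain u v hr0 hr, ?_, ?_⟩
    · exact (differentiableOn_pfaffContinuation _ _ _ _ _ u v hc hr0 hr).sub
        (DifferentiableOn.mul (by fun_prop)
          (differentiableOn_pfaffContinuation _ _ _ _ _ u v hc1 hr0 hr))
    · filter_upwards [eventually_norm_mul_lt u one_pos,
        eventually_norm_mul_lt v (show (0 : ℝ) < 1 / 3 by norm_num)] with s h1 h2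
      rw [appellF3Series_contiguous a a' b b' c hc h1 (by linarith),
        appellF3Series_eq_pfaff a (a' + 1) b b' c hc h1 h2,
        appellF3Series_eq_pfaff a (a' + 1) b (b' + 1) (c + 1) hc1 h1 h2]
      rfl
  rw [appellF3_eq_pfaffContinuation a (a' + 1) b b' c u v hc hr h,
    appellF3_eq_pfaffContinuation a (a' + 1) b (b' + 1) (c + 1) u v hc1 hr h,
    appellF3, starContinuation_eq hcont h, one_mul]

/-- The restriction of `F₃` to the curve `(1 - u) (1 - v) = 1`, parametrised by
`u = 1 - y`, `v = 1 - 1 / y`. -/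
noncomputable def appellF3Curve (a a' b b' c : ℂ) (y : ℝ) : ℂ :=
  appellF3 a a' b b' c (1 - (y : ℂ)) (1 - 1 / (y : ℂ))

/-- Every point of the curve with `0 < y < 1` is reached by the continuation. -/
lemma exists_one_mem_pfaffDomain {y : ℝ} (hy0 : 0 < y) (hy1 : y < 1) :
    ∃ r < 1, (1 : ℂ) ∈ pfaffDomain (1 - (y : ℂ)) (1 - 1 / (y : ℂ)) r := by
  refine ⟨1 - y / 2, by linarith, ?_, ?_⟩
  · rw [one_mul, ← Complex.ofReal_one, ← Complex.ofReal_sub, Complex.norm_real,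
      Real.norm_of_nonneg (by linarith)]
    linarith
  · rw [one_mul, sub_sub_cancel, ← Complex.ofReal_one, ← Complex.ofReal_div, ← Complex.ofReal_sub,
      Complex.norm_real, Complex.norm_real, norm_sub_rev,
      Real.norm_of_nonneg (show 0 ≤ 1 / y by positivity),
      Real.norm_of_nonneg (by rw [sub_nonneg, le_div_iff₀ hy0]; linarith)]
    rw [div_sub_one hy0.ne', mul_one_div]
    gcongr
    linarith

/-- On the curve, `F₃` is a single power series in `1 - y`, since Pfaff's transformation maps
`v` to `v / (v - 1) = 1 - y = u`. -/
lemma appellF3Curve_eq_tsum (a a' b b' c : ℂ) (hc : 0 < c.re) {y : ℝ} (hy0 : 0 < y) (hy1 : y < 1) :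
    appellF3Curve a a' b b' c y =
      (y : ℂ) ^ a' * ∑' k : ℕ × ℕ, pfaffCoeff a a' b b' c k * (1 - (y : ℂ)) ^ (k.1 + k.2) := by
  obtain ⟨r, hr, h⟩ := exists_one_mem_pfaffDomain hy0 hy1
  have hy : (y : ℂ) ≠ 0 := by exact_mod_cast hy0.ne'
  rw [appellF3Curve, appellF3_eq_pfaffContinuation _ _ _ _ _ _ _ hc hr h, pfaffContinuation]
  have e1 : (1 : ℂ) * (1 - 1 / (y : ℂ)) / (1 * (1 - 1 / (y : ℂ)) - 1) = 1 - y := by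
    rw [one_mul, show 1 - 1 / (y : ℂ) - 1 = -(1 / y) by ring]
    field_simp
    ring
  have e2 : (1 - 1 * (1 - 1 / (y : ℂ))) ^ (-a') = (y : ℂ) ^ a' := by
    rw [one_mul, sub_sub_cancel, one_div, Complex.inv_cpow, Complex.cpow_neg, inv_inv]
    rw [Complex.arg_ofReal_of_nonneg hy0.le]
    exact Real.pi_pos.ne
  rw [e1, e2]
  simp only [one_mul, pow_add, mul_assoc]

lemma appellF3Curve_contiguous (a a' b b' c : ℂ) (hc : 0 < c.re) {y : ℝ} (hy0 : 0 < y)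
    (hy1 : y < 1) :
    appellF3Curve a a' b b' c y = appellF3Curve a (a' + 1) b b' c y +
      b' / c * ((1 - y) / y) * appellF3Curve a (a' + 1) b (b' + 1) (c + 1) y := by
  obtain ⟨r, hr, h⟩ := exists_one_mem_pfaffDomain hy0 hy1
  have hy : (y : ℂ) ≠ 0 := by exact_mod_cast hy0.ne'
  rw [appellF3Curve, appellF3_contiguous _ _ _ _ _ _ _ hc hr h, appellF3Curve, appellF3Curve]
  field_simp
  ring

/-! ### The Mellin transform of the third Appell function on the curve -/

lemma integrable_of_hasSum_of_summable_integral_norm {X ι : Type*} [MeasurableSpace X]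
    {μ : Measure X} [Countable ι] {F : ι → X → ℂ} {g : X → ℂ}
    (hF : ∀ i, Integrable (F i) μ) (hsum : Summable fun i => ∫ x, ‖F i x‖ ∂μ)
    (h : ∀ᵐ x ∂μ, HasSum (fun i => F i x) (g x)) : Integrable g μ := by
  refine ⟨aestronglyMeasurable_of_tendsto_ae (u := (atTop : Filter (Finset ι)))
    (f := fun s x => ∑ i ∈ s, F i x)
    (fun s => Finset.aestronglyMeasurable_fun_sum s fun i _ => (hF i).1) h, ?_⟩
  have h1 : ∫⁻ x, ‖g x‖ₑ ∂μ ≤ ∫⁻ x, ∑' i, ‖F i x‖ₑ ∂μ := by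
    refine lintegral_mono_ae (h.mono fun x hx => ?_)
    rw [← hx.tsum_eq]
    exact enorm_tsum_le_tsum_enorm
  refine h1.trans_lt ?_
  rw [lintegral_tsum fun i => (hF i).1.enorm]
  simp only [← fun i => ofReal_integral_norm_eq_lintegral_enorm (hF i)]
  rw [← ENNReal.ofReal_tsum_of_nonneg (fun _ => integral_nonneg fun _ => norm_nonneg _) hsum]
  exact ENNReal.ofReal_lt_top

lemma integrableOn_beta {s t : ℂ} (hs : 0 < s.re) (ht : 0 < t.re) :
    IntegrableOn (fun y : ℝ => (y : ℂ) ^ (s - 1) * (1 - (y : ℂ)) ^ (t - 1)) (Set.Ioo 0 1) :=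
  ((intervalIntegrable_iff_integrableOn_Ioc_of_le zero_le_one).1
    (Complex.betaIntegral_convergent hs ht)).mono_set Set.Ioo_subset_Ioc_self

lemma integral_beta {s t : ℂ} (hs : 0 < s.re) (ht : 0 < t.re) :
    ∫ y in Set.Ioo (0 : ℝ) 1, (y : ℂ) ^ (s - 1) * (1 - (y : ℂ)) ^ (t - 1) =
      Complex.Gamma s * Complex.Gamma t / Complex.Gamma (s + t) := by
  rw [← Complex.betaIntegral_eq_Gamma_mul_div s t hs ht, Complex.betaIntegral,
    intervalIntegral.integral_of_le zero_le_one, integral_Ioc_eq_integral_Ioo]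

lemma one_sub_cpow_add_nat {y : ℝ} (hy : y < 1) (t : ℂ) (N : ℕ) :
    (1 - (y : ℂ)) ^ (t + N - 1) = (1 - (y : ℂ)) ^ (t - 1) * (1 - (y : ℂ)) ^ N := by
  have h : 1 - (y : ℂ) ≠ 0 := by
    rw [sub_ne_zero]
    exact_mod_cast hy.ne'
  rw [← Complex.cpow_natCast, ← Complex.cpow_add _ _ h]
  congr 1
  ring

lemma integrableOn_beta_mul_pow {s t : ℂ} (hs : 0 < s.re) (ht : 0 < t.re) (N : ℕ) :
    IntegrableOn (fun y : ℝ => (y : ℂ) ^ (s - 1) * (1 - (y : ℂ)) ^ (t - 1) * (1 - (y : ℂ)) ^ N)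
      (Set.Ioo 0 1) := by
  refine (integrableOn_beta hs (t := t + N) (by simp; positivity)).congr_fun (fun y hy => ?_)
    measurableSet_Ioo
  simp only
  rw [one_sub_cpow_add_nat hy.2, mul_assoc]

lemma integral_beta_mul_pow {s t : ℂ} (hs : 0 < s.re) (ht : 0 < t.re) (N : ℕ) :
    ∫ y in Set.Ioo (0 : ℝ) 1, (y : ℂ) ^ (s - 1) * (1 - (y : ℂ)) ^ (t - 1) * (1 - (y : ℂ)) ^ N =
      Complex.Gamma s * (poch t N * Complex.Gamma t) * (Complex.Gamma (s + t + N))⁻¹ := by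
  rw [← Gamma_add_nat_eq_poch_mul (ne_neg_natCast_of_re_pos ht), add_assoc, ← div_eq_mul_inv,
    ← integral_beta hs (t := t + N) (by simp; positivity)]
  refine setIntegral_congr_fun measurableSet_Ioo fun y hy => ?_
  rw [one_sub_cpow_add_nat hy.2, mul_assoc]

lemma exists_integral_norm_beta_le {s t : ℂ} (hs : 0 < s.re) (ht : 0 < t.re) :
    ∃ D : ℝ, 0 < D ∧ ∀ N : ℕ, ∫ y in Set.Ioo (0 : ℝ) 1,
      ‖(y : ℂ) ^ (s - 1) * (1 - (y : ℂ)) ^ (t - 1) * (1 - (y : ℂ)) ^ N‖ ≤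
        D * ((N : ℝ) + 1) ^ (-s.re) := by
  have hs' : 0 < (s.re : ℂ).re := by simpa using hs
  have ht' : 0 < (t.re : ℂ).re := by simpa using ht
  have hst : 0 < ((s.re : ℂ) + t.re).re := by simp; linarith
  obtain ⟨C, hC, h⟩ := exists_norm_poch_div_poch_zero_le (t.re : ℂ) ((s.re : ℂ) + t.re) hst
  have hG : Complex.Gamma s.re * Complex.Gamma t.re / Complex.Gamma ((s.re : ℂ) + t.re) ≠ 0 :=
    div_ne_zero (mul_ne_zero (Complex.Gamma_ne_zero_of_re_pos hs')
      (Complex.Gamma_ne_zero_of_re_pos ht')) (Complex.Gamma_ne_zero_of_re_pos hst)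
  refine ⟨‖Complex.Gamma s.re * Complex.Gamma t.re / Complex.Gamma ((s.re : ℂ) + t.re)‖ * C,
    mul_pos (norm_pos_iff.2 hG) hC, fun N => ?_⟩
  have e1 : ((∫ y in Set.Ioo (0 : ℝ) 1,
      ‖(y : ℂ) ^ (s - 1) * (1 - (y : ℂ)) ^ (t - 1) * (1 - (y : ℂ)) ^ N‖ : ℝ) : ℂ) =
      ∫ y in Set.Ioo (0 : ℝ) 1, (y : ℂ) ^ ((s.re : ℂ) - 1) * (1 - (y : ℂ)) ^ ((t.re : ℂ) - 1) *
        (1 - (y : ℂ)) ^ N := by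
    rw [← integral_complex_ofReal]
    refine setIntegral_congr_fun measurableSet_Ioo fun y hy => ?_
    have h1 : (0 : ℝ) < 1 - y := sub_pos.2 hy.2
    rw [← Complex.ofReal_one, ← Complex.ofReal_sub, norm_mul, norm_mul, norm_pow,
      Complex.norm_cpow_eq_rpow_re_of_pos hy.1, Complex.norm_cpow_eq_rpow_re_of_pos h1,
      Complex.norm_real, Real.norm_of_nonneg h1.le, ← Complex.ofReal_sub, ← Complex.ofReal_sub,
      ← Complex.ofReal_cpow hy.1.le, ← Complex.ofReal_cpow h1.le, ← Complex.ofReal_pow,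
      ← Complex.ofReal_mul, ← Complex.ofReal_mul]
    simp
  have e2 : ∫ y in Set.Ioo (0 : ℝ) 1,
      ‖(y : ℂ) ^ (s - 1) * (1 - (y : ℂ)) ^ (t - 1) * (1 - (y : ℂ)) ^ N‖ =
      ‖Complex.Gamma s.re * Complex.Gamma t.re / Complex.Gamma ((s.re : ℂ) + t.re)‖ *
        ‖poch t.re N / poch ((s.re : ℂ) + t.re) N‖ := by
    rw [← Real.norm_of_nonneg (integral_nonneg fun _ => norm_nonneg _), ← Complex.norm_real, e1,
      integral_beta_mul_pow hs' ht', ← norm_mul,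
      Gamma_add_nat_eq_poch_mul (ne_neg_natCast_of_re_pos hst), mul_inv]
    congr 1
    ring
  rw [e2, mul_assoc]
  gcongr
  simpa using h N

/-- The value of the Mellin transform `∫₀¹ y ^ (s - 1) (1 - y) ^ (c - 1) F₃ dy` along the curve. -/
noncomputable def curveMellin (a a' b b' c s : ℂ) : ℂ :=
  Complex.Gamma c * Complex.Gamma (s + a') * Complex.Gamma (s + b') * Complex.Gamma (s + c - a - b) *
    (Complex.Gamma (s + c - a))⁻¹ * (Complex.Gamma (s + a' + b'))⁻¹ * (Complex.Gamma (s + c - b))⁻¹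

/-- For `0 < Re a'` the double series can be integrated term by term on the whole domain of the
Mellin transform: this is the corresponding absolute convergence. -/
lemma summable_norm_pfaffCoeff_mul_rpow {a a' b b' c s : ℂ} (hc : 0 < c.re) (ha' : 0 < a'.re)
    (hb : 0 < (s + b').re) (hab : 0 < (s + c - a - b).re) :
    Summable fun k : ℕ × ℕ =>
      ‖pfaffCoeff a a' b b' c k‖ * (((k.1 + k.2 : ℕ) : ℝ) + 1) ^ (-(s + a').re) := by
  obtain ⟨C, hC, h⟩ := exists_norm_pfaffCoeff_le a a' b b' c hc
  -- The weight `(m + n + 1) ^ (-(p + q))` is split as `(n + 1) ^ (-p) * (m + 1) ^ (-q)`.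
  set ε := min (s + b').re (s + c - a - b).re / 2 with hε
  have hε0 : 0 < ε := half_pos (lt_min hb hab)
  have hε1 : 2 * ε ≤ (s + b').re := by
    rw [hε, mul_div_cancel₀ _ (two_ne_zero)]; exact min_le_left _ _
  have hε2 : 2 * ε ≤ (s + c - a - b).re := by
    rw [hε, mul_div_cancel₀ _ (two_ne_zero)]; exact min_le_right _ _
  simp only [Complex.add_re, Complex.sub_re] at hε1 hε2
  set p := a'.re + ε with hp
  set q := b'.re + s.re - ε with hq
  have hsum := ((summable_nat_add_one_rpow (p := (a + b - c).re - 1 + b'.re - q)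
    (by simp only [hq, Complex.add_re, Complex.sub_re]; linarith)).mul_of_nonneg
    (summable_nat_add_one_rpow (p := a'.re - 1 - p) (by simp only [hp]; linarith))
    (fun _ => by positivity) (fun _ => by positivity)).mul_left C
  refine Summable.of_nonneg_of_le (fun _ => by positivity) (fun ⟨m, n⟩ => ?_) hsum
  have hm : (0 : ℝ) < (m : ℝ) + 1 := by positivity
  have hn : (0 : ℝ) < (n : ℝ) + 1 := by positivity
  have hmn : (0 : ℝ) < (m : ℝ) + n + 1 := by positivity
  have hsplit : ((m : ℝ) + n + 1) ^ (-(p + q)) ≤ ((n : ℝ) + 1) ^ (-p) * ((m : ℝ) + 1) ^ (-q) := by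
    rw [neg_add, Real.rpow_add hmn]
    gcongr ?_ * ?_
    · exact Real.rpow_le_rpow_of_nonpos hn (by linarith [(m.cast_nonneg : (0 : ℝ) ≤ m)])
        (by simp only [hp]; linarith)
    · exact Real.rpow_le_rpow_of_nonpos hm (by linarith [(n.cast_nonneg : (0 : ℝ) ≤ n)])
        (by simp only [hq]; linarith)
  have e0 : ((m : ℝ) + n + 1) ^ (-(s + a').re) * (((m : ℝ) + n + 1) / (m + 1)) ^ (-b'.re) =
      ((m : ℝ) + n + 1) ^ (-(p + q)) * ((m : ℝ) + 1) ^ b'.re := by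
    rw [Real.div_rpow hmn.le hm.le, Real.rpow_neg hm.le b'.re, div_inv_eq_mul, ← mul_assoc,
      ← Real.rpow_add hmn]
    congr 2
    simp only [hp, hq, Complex.add_re]
    ring
  push_cast
  calc _ ≤ C * (((m : ℝ) + 1) ^ ((a + b - c).re - 1) * ((n : ℝ) + 1) ^ (a'.re - 1) *
        (((m : ℝ) + n + 1) / (m + 1)) ^ (-b'.re)) * ((m : ℝ) + n + 1) ^ (-(s + a').re) := by
        gcongr
        exact h (m, n)
    _ = C * (((m : ℝ) + 1) ^ ((a + b - c).re - 1) * ((n : ℝ) + 1) ^ (a'.re - 1)) *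
        (((m : ℝ) + n + 1) ^ (-(s + a').re) * (((m : ℝ) + n + 1) / (m + 1)) ^ (-b'.re)) := by ring
    _ ≤ C * (((m : ℝ) + 1) ^ ((a + b - c).re - 1) * ((n : ℝ) + 1) ^ (a'.re - 1)) *
        (((n : ℝ) + 1) ^ (-p) * ((m : ℝ) + 1) ^ (-q) * ((m : ℝ) + 1) ^ b'.re) := by
        rw [e0]
        gcongr
    _ = _ := by
        simp only [sub_eq_add_neg _ p, sub_eq_add_neg _ q, Real.rpow_add hm, Real.rpow_add hn]
        ring

/-- Gauss's theorem, applied to the inner and then to the outer sum, evaluates the series of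
termwise integrals. -/
lemma tsum_pfaffCoeff_mul_beta {a a' b b' c s : ℂ} (hc : 0 < c.re)
    (hb : 0 < (s + b').re) (hab : 0 < (s + c - a - b).re)
    (hsum : Summable fun k : ℕ × ℕ => pfaffCoeff a a' b b' c k * (Complex.Gamma (s + a') *
      (poch c (k.1 + k.2) * Complex.Gamma c) * (Complex.Gamma (s + a' + c + (k.1 + k.2 : ℕ)))⁻¹)) :
    ∑' k : ℕ × ℕ, pfaffCoeff a a' b b' c k * (Complex.Gamma (s + a') *
      (poch c (k.1 + k.2) * Complex.Gamma c) * (Complex.Gamma (s + a' + c + (k.1 + k.2 : ℕ)))⁻¹) =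
      curveMellin a a' b b' c s := by
  have e1 : ∀ m n : ℕ, pfaffCoeff a a' b b' c (m, n) * (Complex.Gamma (s + a') *
      (poch c (m + n) * Complex.Gamma c) * (Complex.Gamma (s + a' + c + (m + n : ℕ)))⁻¹) =
      Complex.Gamma (s + a') * Complex.Gamma c * (poch a m * poch b m / m.factorial) *
        gaussTerm a' (c - b' + m) (s + a' + c + m) n := fun m n => by
    have hp := poch_ne_zero_of_re_pos hc (m + n)
    have hm : (m.factorial : ℂ) ≠ 0 := by exact_mod_cast m.factorial_ne_zero
    have hn : (n.factorial : ℂ) ≠ 0 := by exact_mod_cast n.factorial_ne_zero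
    rw [pfaffCoeff, gaussTerm, Nat.cast_add, ← add_assoc (s + a' + c)]
    field_simp
  have e2 : ∀ m : ℕ, ∑' n, gaussTerm a' (c - b' + m) (s + a' + c + m) n =
      Complex.Gamma (s + b') * (Complex.Gamma (s + a' + b'))⁻¹ *
        (Complex.Gamma (s + c + m))⁻¹ := fun m => by
    have e3 : s + a' + c + m - a' - (c - b' + m) = s + b' := by ring
    rw [tsum_gaussTerm (by rwa [e3]), e3, show s + a' + c + m - a' = s + c + m by ring,
      show s + a' + c + m - (c - b' + m) = s + a' + b' by ring]
    ring
  have e4 : ∀ m : ℕ, Complex.Gamma (s + a') * Complex.Gamma c * (poch a m * poch b m / m.factorial) *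
      (Complex.Gamma (s + b') * (Complex.Gamma (s + a' + b'))⁻¹ * (Complex.Gamma (s + c + m))⁻¹) =
      Complex.Gamma (s + a') * Complex.Gamma c * Complex.Gamma (s + b') *
        (Complex.Gamma (s + a' + b'))⁻¹ * gaussTerm a b (s + c) m := fun m => by
    rw [gaussTerm]; ring
  rw [hsum.tsum_prod]
  simp only [e1, tsum_mul_left, e2, e4]
  rw [tsum_gaussTerm hab, curveMellin]
  ring

/-- The Mellin integrand as a double series of Beta integrands. -/
lemma hasSum_mellin_integrand (a a' b b' c s : ℂ) (hc : 0 < c.re) {y : ℝ}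
    (hy0 : 0 < y) (hy1 : y < 1) :
    HasSum (fun k : ℕ × ℕ => pfaffCoeff a a' b b' c k *
      ((y : ℂ) ^ (s + a' - 1) * (1 - (y : ℂ)) ^ (c - 1) * (1 - (y : ℂ)) ^ (k.1 + k.2)))
      ((y : ℂ) ^ (s - 1) * (1 - (y : ℂ)) ^ (c - 1) * appellF3Curve a a' b b' c y) := by
  have hy : (y : ℂ) ≠ 0 := by exact_mod_cast hy0.ne'
  have hn : ‖1 - (y : ℂ)‖ < 1 := by
    rw [← Complex.ofReal_one, ← Complex.ofReal_sub, Complex.norm_real,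
      Real.norm_of_nonneg (by linarith)]
    linarith
  have h := (summable_pfaffCoeff a a' b b' c hc hn hn).hasSum.mul_left
    ((y : ℂ) ^ (s + a' - 1) * (1 - (y : ℂ)) ^ (c - 1))
  simp only [mul_assoc, ← pow_add] at h
  have e : (y : ℂ) ^ (s - 1) * (1 - (y : ℂ)) ^ (c - 1) * appellF3Curve a a' b b' c y =
      (y : ℂ) ^ (s + a' - 1) * ((1 - (y : ℂ)) ^ (c - 1) *
        ∑' k : ℕ × ℕ, pfaffCoeff a a' b b' c k * (1 - (y : ℂ)) ^ (k.1 + k.2)) := by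
    rw [appellF3Curve_eq_tsum a a' b b' c hc hy0 hy1, show s + a' - 1 = (s - 1) + a' by ring,
      Complex.cpow_add _ _ hy]
    ring
  have hf : (fun k : ℕ × ℕ => pfaffCoeff a a' b b' c k *
      ((y : ℂ) ^ (s + a' - 1) * (1 - (y : ℂ)) ^ (c - 1) * (1 - (y : ℂ)) ^ (k.1 + k.2))) =
      fun k => (y : ℂ) ^ (s + a' - 1) * ((1 - (y : ℂ)) ^ (c - 1) *
        (pfaffCoeff a a' b b' c k * (1 - (y : ℂ)) ^ (k.1 + k.2))) := by
    funext k
    ring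
  rw [e, hf]
  exact h

/-- The Mellin transform of `F₃` along the curve. For `0 < Re a'` it is computed termwise; the
general case follows from the contiguous relation, which shifts `(a', b', c, s)` to
`(a' + 1, b', c, s)` and `(a' + 1, b' + 1, c + 1, s - 1)` and preserves the domain. -/
theorem mellin_appellF3Curve {a a' b b' c s : ℂ} (hc : 0 < c.re) (ha : 0 < (s + a').re)
    (hb : 0 < (s + b').re) (hab : 0 < (s + c - a - b).re) :
    IntegrableOn (fun y : ℝ => (y : ℂ) ^ (s - 1) * (1 - (y : ℂ)) ^ (c - 1) *
      appellF3Curve a a' b b' c y) (Set.Ioo 0 1) ∧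
    ∫ y in Set.Ioo (0 : ℝ) 1, (y : ℂ) ^ (s - 1) * (1 - (y : ℂ)) ^ (c - 1) *
      appellF3Curve a a' b b' c y = curveMellin a a' b b' c s := by
  obtain ⟨M, hM⟩ := exists_nat_gt (-a'.re)
  induction M generalizing a' b' c s with
  | zero =>
    have ha' : 0 < a'.re := by simpa using hM
    have hpt : ∀ᵐ y : ℝ ∂(volume.restrict (Set.Ioo (0 : ℝ) 1)), HasSum (fun k : ℕ × ℕ =>
        pfaffCoeff a a' b b' c k *
          ((y : ℂ) ^ (s + a' - 1) * (1 - (y : ℂ)) ^ (c - 1) * (1 - (y : ℂ)) ^ (k.1 + k.2)))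
        ((y : ℂ) ^ (s - 1) * (1 - (y : ℂ)) ^ (c - 1) * appellF3Curve a a' b b' c y) :=
      (ae_restrict_iff' measurableSet_Ioo).2 (Eventually.of_forall fun y hy =>
        hasSum_mellin_integrand a a' b b' c s hc hy.1 hy.2)
    have hint : ∀ k : ℕ × ℕ, Integrable (fun y : ℝ => pfaffCoeff a a' b b' c k *
          ((y : ℂ) ^ (s + a' - 1) * (1 - (y : ℂ)) ^ (c - 1) * (1 - (y : ℂ)) ^ (k.1 + k.2)))
          (volume.restrict (Set.Ioo (0 : ℝ) 1)) := fun k =>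
      Integrable.const_mul (integrableOn_beta_mul_pow ha hc _) _
    have hnorm : Summable fun k : ℕ × ℕ => ∫ y in Set.Ioo (0 : ℝ) 1, ‖pfaffCoeff a a' b b' c k *
          ((y : ℂ) ^ (s + a' - 1) * (1 - (y : ℂ)) ^ (c - 1) * (1 - (y : ℂ)) ^ (k.1 + k.2))‖ := by
      obtain ⟨D, hD, h⟩ := exists_integral_norm_beta_le ha hc
      refine Summable.of_nonneg_of_le (fun _ => integral_nonneg fun _ => norm_nonneg _) (fun k => ?_)
        ((summable_norm_pfaffCoeff_mul_rpow hc ha' hb hab).mul_left D)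
      simp only [norm_mul (pfaffCoeff a a' b b' c k)]
      rw [integral_const_mul]
      calc _ ≤ ‖pfaffCoeff a a' b b' c k‖ * (D * (((k.1 + k.2 : ℕ) : ℝ) + 1) ^ (-(s + a').re)) := by
            gcongr
            exact h _
        _ = _ := by ring
    refine ⟨integrable_of_hasSum_of_summable_integral_norm hint hnorm hpt, ?_⟩
    have hS := hasSum_integral_of_summable_integral_norm hint hnorm
    have e : ∫ y in Set.Ioo (0 : ℝ) 1, (y : ℂ) ^ (s - 1) * (1 - (y : ℂ)) ^ (c - 1) *
        appellF3Curve a a' b b' c y = ∫ y in Set.Ioo (0 : ℝ) 1, ∑' k : ℕ × ℕ,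
          pfaffCoeff a a' b b' c k *
          ((y : ℂ) ^ (s + a' - 1) * (1 - (y : ℂ)) ^ (c - 1) * (1 - (y : ℂ)) ^ (k.1 + k.2)) :=
      integral_congr_ae (hpt.mono fun y hy => hy.tsum_eq.symm)
    simp only [integral_const_mul, integral_beta_mul_pow ha hc] at hS
    rw [e, ← hS.tsum_eq]
    exact tsum_pfaffCoeff_mul_beta hc hb hab hS.summable
  | succ M ih =>
    have hM' : -(a' + 1).re < M := by push_cast at hM; simp; linarith
    simp only [Complex.add_re, Complex.sub_re] at ha hb hab
    obtain ⟨i1, v1⟩ := ih (a' := a' + 1) (b' := b') (c := c) (s := s) hc (by simp; linarith)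
      (by simp; linarith) (by simp; linarith) hM'
    obtain ⟨i2, v2⟩ := ih (a' := a' + 1) (b' := b' + 1) (c := c + 1) (s := s - 1)
      (by simp; linarith) (by simp; linarith) (by simp; linarith) (by simp; linarith) hM'
    have hpt : ∀ y ∈ Set.Ioo (0 : ℝ) 1, (y : ℂ) ^ (s - 1) * (1 - (y : ℂ)) ^ (c - 1) *
          appellF3Curve a (a' + 1) b b' c y + b' / c * ((y : ℂ) ^ (s - 1 - 1) *
          (1 - (y : ℂ)) ^ (c + 1 - 1) * appellF3Curve a (a' + 1) b (b' + 1) (c + 1) y) =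
        (y : ℂ) ^ (s - 1) * (1 - (y : ℂ)) ^ (c - 1) * appellF3Curve a a' b b' c y := by
      intro y hy
      have hy0 : (y : ℂ) ≠ 0 := by exact_mod_cast hy.1.ne'
      have h1 := one_sub_cpow_add_nat hy.2 c 1
      rw [Nat.cast_one, pow_one] at h1
      rw [appellF3Curve_contiguous a a' b b' c hc hy.1 hy.2, h1,
        Complex.cpow_sub (s - 1) 1 hy0, Complex.cpow_one]
      ring
    have hi : Integrable _ (volume.restrict (Set.Ioo (0 : ℝ) 1)) := i1.add (i2.const_mul (b' / c))
    refine ⟨IntegrableOn.congr_fun hi hpt measurableSet_Ioo, ?_⟩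
    rw [← setIntegral_congr_fun measurableSet_Ioo hpt, integral_add i1 (i2.const_mul _),
      integral_const_mul, v1, v2]
    have hc0 : c ≠ 0 := by rintro rfl; simp at hc
    have hsa : s + a' ≠ 0 := by
      intro h
      have := congrArg Complex.re h
      simp at this
      linarith
    simp only [curveMellin]
    rw [show s - 1 + (a' + 1) = s + a' by ring, show s - 1 + (b' + 1) = s + b' by ring,
      show s - 1 + (c + 1) = s + c by ring, show s + (a' + 1) = s + a' + 1 by ring,
      show s + a' + (b' + 1) = s + a' + b' + 1 by ring,
      show s + a' + 1 + b' = s + a' + b' + 1 by ring, Complex.Gamma_add_one _ hc0,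
      Complex.Gamma_add_one _ hsa,
      Complex.one_div_Gamma_eq_self_mul_one_div_Gamma_add_one (s + a' + b')]
    field_simp

lemma curveMellin_add_two_mul {a a' b b' c s : ℂ} (h1 : 0 < (s + a').re) (h2 : 0 < (s + b').re)
    (h3 : 0 < (s + c - a - b).re) (h4 : ∀ n : ℕ, s + c - a ≠ -(n : ℂ))
    (h5 : ∀ n : ℕ, s + a' + b' ≠ -(n : ℂ)) (h6 : ∀ n : ℕ, s + c - b ≠ -(n : ℂ)) (k : ℕ) :
    curveMellin a a' b b' c (s + (2 * k : ℕ)) = curveMellin a a' b b' c s *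
      (poch (s + a') (2 * k) * poch (s + b') (2 * k) * poch (s + c - a - b) (2 * k) /
        (poch (s + c - a) (2 * k) * poch (s + a' + b') (2 * k) * poch (s + c - b) (2 * k))) := by
  simp only [curveMellin]
  rw [show s + (2 * k : ℕ) + a' = s + a' + (2 * k : ℕ) by ring,
    show s + (2 * k : ℕ) + b' = s + b' + (2 * k : ℕ) by ring,
    show s + (2 * k : ℕ) + c - a = s + c - a + (2 * k : ℕ) by ring,
    show s + a' + (2 * k : ℕ) + b' = s + a' + b' + (2 * k : ℕ) by ring,
    show s + (2 * k : ℕ) + c - b = s + c - b + (2 * k : ℕ) by ring,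
    show s + c - a + (2 * k : ℕ) - b = s + c - a - b + (2 * k : ℕ) by ring,
    Gamma_add_nat_eq_poch_mul (ne_neg_natCast_of_re_pos h1),
    Gamma_add_nat_eq_poch_mul (ne_neg_natCast_of_re_pos h2),
    Gamma_add_nat_eq_poch_mul (ne_neg_natCast_of_re_pos h3),
    Gamma_add_nat_eq_poch_mul h4, Gamma_add_nat_eq_poch_mul h5, Gamma_add_nat_eq_poch_mul h6]
  simp only [mul_inv, div_eq_mul_inv]
  ring

/-! ### The generalized Bessel function -/

/-- The coefficient of `(z / 2) ^ (2 * k + p)` in the generalized Bessel function, where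
`κ = p + (b + 1) / 2`. -/
noncomputable def besselCoeff (κ c : ℂ) (k : ℕ) : ℂ :=
  (-1) ^ k * c ^ k / (Complex.Gamma (κ + k) * (k.factorial : ℂ))

lemma summable_norm_besselCoeff (κ c : ℂ) {R : ℝ} (hR : 0 ≤ R) :
    Summable fun k : ℕ => ‖besselCoeff κ c k‖ * R ^ k := by
  obtain ⟨C, hC, h⟩ := exists_norm_inv_Gamma_add_nat_le κ
  set Q := ‖c‖ * R with hQ
  have hQ0 : 0 ≤ Q := by positivity
  refine Summable.of_nonneg_of_le (fun _ => by positivity) (fun k => ?_)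
    ((summable_rpow_mul_pow (1 - κ.re) (r := 1 / 2) (by norm_num) (by norm_num)).mul_left
      (C * Real.exp (2 * Q)))
  have hk : (1 : ℝ) ≤ k.factorial := by exact_mod_cast k.factorial_pos
  have hk0 : (k.factorial : ℂ) ≠ 0 := by exact_mod_cast k.factorial_ne_zero
  have e : besselCoeff κ c k = (-1) ^ k * c ^ k * (k.factorial * (Complex.Gamma (κ + k))⁻¹) /
      ((k.factorial : ℂ) * k.factorial) := by
    rw [besselCoeff, div_eq_mul_inv, mul_inv]
    field_simp
  have h1 : (2 * Q) ^ k / k.factorial ≤ Real.exp (2 * Q) :=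
    Real.pow_div_factorial_le_exp _ (by positivity) k
  rw [e, norm_div, norm_mul, norm_mul ((-1) ^ k), norm_mul (k.factorial : ℂ) (k.factorial : ℂ),
    norm_pow, norm_pow, norm_neg, norm_one, one_pow,
    one_mul, Complex.norm_natCast]
  calc _ ≤ ‖c‖ ^ k * (C * ((k : ℝ) + 1) ^ (1 - κ.re)) / (1 * k.factorial) * R ^ k := by
        exact mul_le_mul_of_nonneg_right (div_le_div₀ (by positivity)
          (mul_le_mul_of_nonneg_left (h k) (by positivity)) (by positivity)
          (mul_le_mul_of_nonneg_right hk (by positivity))) (by positivity)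
    _ = C * ((2 * Q) ^ k / k.factorial) * (((k : ℝ) + 1) ^ (1 - κ.re) * (1 / 2) ^ k) := by
        rw [hQ, mul_pow, mul_pow, one_div, inv_pow]
        field_simp
    _ ≤ _ := by gcongr

/-- The `k`-th term of the Mellin transform of `F₃` times the generalized Bessel function, reduced
to the `k`-th term of `₆F₇` by the duplication formula `(z)₂ₖ = 4 ^ k (z / 2)ₖ ((z + 1) / 2)ₖ`. -/
lemma besselCoeff_mul_curveMellin {a a' b b' γ s κ : ℂ} (h1 : 0 < (s + a').re)
    (h2 : 0 < (s + b').re) (h3 : 0 < (s + γ - a - b).re) (h4 : ∀ n : ℕ, s + γ - a ≠ -(n : ℂ))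
    (h5 : ∀ n : ℕ, s + a' + b' ≠ -(n : ℂ)) (h6 : ∀ n : ℕ, s + γ - b ≠ -(n : ℂ))
    (hκ : ∀ n : ℕ, κ ≠ -(n : ℂ)) (c : ℂ) (x : ℝ) (k : ℕ) :
    besselCoeff κ c k * ((1 / (4 * x ^ 2) : ℝ) : ℂ) ^ k *
      curveMellin a a' b b' γ (s + (2 * k : ℕ)) =
      curveMellin a a' b b' γ s * (Complex.Gamma κ)⁻¹ *
        (([(s + a') / 2, (s + a' + 1) / 2, (s + b') / 2, (s + b' + 1) / 2,
          (s + γ - a - b) / 2, (s + γ - a - b + 1) / 2].map fun a => poch a k).prod /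
        (([κ, (s + γ - a) / 2, (s + γ - a + 1) / 2, (s + a' + b') / 2, (s + a' + b' + 1) / 2,
          (s + γ - b) / 2, (s + γ - b + 1) / 2].map fun b => poch b k).prod * poch 1 k) *
          (-(c / (4 * (x : ℂ) ^ 2))) ^ k) := by
  rw [curveMellin_add_two_mul h1 h2 h3 h4 h5 h6]
  simp only [poch_two_mul, List.map_cons, List.map_nil, List.prod_cons, List.prod_nil, mul_one,
    besselCoeff, Gamma_add_nat_eq_poch_mul hκ, poch_one]
  have h4k : (4 : ℂ) ^ k ≠ 0 := pow_ne_zero _ (by norm_num)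
  have hz : (-(c / (4 * (x : ℂ) ^ 2))) ^ k =
      (-1) ^ k * c ^ k * ((1 / (4 * x ^ 2) : ℝ) : ℂ) ^ k := by
    rw [← mul_pow, ← mul_pow]
    congr 1
    push_cast
    ring
  have hcancel : ∀ t P Q R P' Q' R' : ℂ, t ≠ 0 →
      t * P * (t * Q) * (t * R) / (t * P' * (t * Q') * (t * R')) = P * Q * R / (P' * Q' * R') := by
    intro t P Q R P' Q' R' ht
    rw [← mul_div_mul_left (P * Q * R) (P' * Q' * R') (pow_ne_zero 3 ht)]
    congr 1 <;> ring
  rw [hz, hcancel _ _ _ _ _ _ _ h4k]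
  simp only [div_eq_mul_inv, mul_inv]
  ring

lemma genBessel_ofReal (p b c : ℂ) {z : ℝ} (hz : 0 < z) :
    genBessel p b c z = ((z / 2 : ℝ) : ℂ) ^ p *
      ∑' k : ℕ, besselCoeff (p + (b + 1) / 2) c k * (((z / 2 : ℝ) : ℂ) ^ 2) ^ k := by
  have h0 : ((z / 2 : ℝ) : ℂ) ≠ 0 := by exact_mod_cast (half_pos hz).ne'
  rw [genBessel, ← tsum_mul_left]
  refine tsum_congr fun k => ?_
  rw [show (z : ℂ) / 2 = ((z / 2 : ℝ) : ℂ) by push_cast; rfl, Complex.cpow_add _ _ h0,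
    ← pow_mul, ← Complex.cpow_natCast _ (2 * k), besselCoeff]
  push_cast
  ring

/-! ### The substitution `t = x / y` and the sum over the Bessel series -/

lemma image_div_Ioo {x : ℝ} (hx : 0 < x) : (fun y : ℝ => x / y) '' Set.Ioo 0 1 = Set.Ioi x := by
  ext t
  constructor
  · rintro ⟨y, ⟨h0, h1⟩, rfl⟩
    rw [Set.mem_Ioi, lt_div_iff₀ h0]
    nlinarith
  · intro ht
    have ht0 : 0 < t := hx.trans ht
    exact ⟨x / t, ⟨by positivity, (div_lt_one ht0).2 ht⟩, by field_simp⟩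

lemma hasDerivWithinAt_div {x y : ℝ} (hy : y ∈ Set.Ioo (0 : ℝ) 1) :
    HasDerivWithinAt (fun y : ℝ => x / y) (-(x / y ^ 2)) (Set.Ioo 0 1) y := by
  have := ((hasDerivAt_inv hy.1.ne').const_mul x).hasDerivWithinAt (s := Set.Ioo 0 1)
  simpa [div_eq_mul_inv] using this

lemma injOn_div {x : ℝ} (hx : 0 < x) : Set.InjOn (fun y : ℝ => x / y) (Set.Ioo 0 1) := by
  intro y _ z _ h
  exact inv_injective (mul_left_cancel₀ hx.ne' (by simpa only [div_eq_mul_inv] using h))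

lemma ofReal_cpow_eq_exp {z : ℝ} (hz : 0 < z) (w : ℂ) :
    (z : ℂ) ^ w = Complex.exp (Real.log z * w) := by
  rw [Complex.cpow_def_of_ne_zero (by exact_mod_cast hz.ne'), Complex.ofReal_log hz.le]

/-- The integrand after `t = x / y`, including the Jacobian `x / y ^ 2`. -/
lemma msmRightIntegrand_div (α α' β β' γ ρ p b c : ℂ) {x y : ℝ} (hx : 0 < x)
    (hy : y ∈ Set.Ioo (0 : ℝ) 1) :
    |-(x / y ^ 2)| • msmRightIntegrand α α' β β' γ
        (fun t : ℝ => (t : ℂ) ^ (ρ - 1) * genBessel p b c (1 / (t : ℂ))) x (x / y) =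
      (x : ℂ) ^ (γ - α + ρ - p - 1) / 2 ^ p *
        ((y : ℂ) ^ (α - γ - ρ + p + 1 - 1) * (1 - (y : ℂ)) ^ (γ - 1) *
          appellF3Curve α α' β β' γ y *
          ∑' k : ℕ, besselCoeff (p + (b + 1) / 2) c k * ((1 / (4 * x ^ 2) : ℝ) * (y : ℂ) ^ 2) ^ k) := by
  obtain ⟨hy0, hy1⟩ := hy
  have hxc : (x : ℂ) ≠ 0 := by exact_mod_cast hx.ne'
  have hyc : (y : ℂ) ≠ 0 := by exact_mod_cast hy0.ne'
  have h1y : 0 < 1 - y := sub_pos.2 hy1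
  have hxy : 0 < x / y := by positivity
  have hsub : 0 < x / y - x := by
    rw [sub_pos, lt_div_iff₀ hy0]
    nlinarith
  have e1 : 1 - (x : ℂ) / ((x / y : ℝ) : ℂ) = 1 - y := by push_cast; field_simp
  have e2 : 1 - ((x / y : ℝ) : ℂ) / x = 1 - 1 / (y : ℂ) := by push_cast; field_simp
  have e3 : 1 / ((x / y : ℝ) : ℂ) = ((y / x : ℝ) : ℂ) := by push_cast; field_simp
  have e4 : (((y / x / 2 : ℝ) : ℂ)) ^ 2 = (1 / (4 * x ^ 2) : ℝ) * (y : ℂ) ^ 2 := by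
    push_cast; field_simp; norm_num
  rw [msmRightIntegrand, e1, e2, e3, genBessel_ofReal p b c (by positivity), e4, abs_neg,
    abs_of_pos (by positivity), Complex.real_smul, ← appellF3Curve]
  have l1 : Real.log (x / y - x) = Real.log x + Real.log (1 - y) - Real.log y := by
    rw [show x / y - x = x * (1 - y) / y by field_simp, Real.log_div (by positivity) hy0.ne',
      Real.log_mul hx.ne' h1y.ne']
  have l2 : Real.log (x / y) = Real.log x - Real.log y := Real.log_div hx.ne' hy0.ne'
  have l3 : Real.log (y / x / 2) = Real.log y - Real.log x - Real.log 2 := by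
    rw [Real.log_div (by positivity) two_ne_zero, Real.log_div hy0.ne' hx.ne']
  have l4 : ((x / y ^ 2 : ℝ) : ℂ) = Complex.exp (Real.log x - 2 * Real.log y) := by
    rw [Complex.exp_sub, two_mul, Complex.exp_add, ← Complex.ofReal_exp, ← Complex.ofReal_exp,
      Real.exp_log hx, Real.exp_log hy0]
    push_cast
    ring
  have key : ((x / y ^ 2 : ℝ) : ℂ) * (((x / y - x : ℝ) : ℂ) ^ (γ - 1) * ((x / y : ℝ) : ℂ) ^ (-α) *
      (((x / y : ℝ) : ℂ) ^ (ρ - 1) * ((y / x / 2 : ℝ) : ℂ) ^ p)) =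
      (x : ℂ) ^ (γ - α + ρ - p - 1) / 2 ^ p *
        ((y : ℂ) ^ (α - γ - ρ + p + 1 - 1) * (1 - (y : ℂ)) ^ (γ - 1)) := by
    rw [show (2 : ℂ) = ((2 : ℝ) : ℂ) by norm_num, ← Complex.ofReal_one, ← Complex.ofReal_sub 1 y,
      l4, ofReal_cpow_eq_exp hsub, ofReal_cpow_eq_exp hxy, ofReal_cpow_eq_exp hxy,
      ofReal_cpow_eq_exp (by positivity : 0 < y / x / 2), ofReal_cpow_eq_exp hx,
      ofReal_cpow_eq_exp hy0, ofReal_cpow_eq_exp h1y, ofReal_cpow_eq_exp two_pos, l1, l2, l3]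
    simp only [← Complex.exp_add, ← Complex.exp_sub]
    congr 1
    push_cast
    ring
  linear_combination (appellF3Curve α α' β β' γ y *
    ∑' k : ℕ, besselCoeff (p + (b + 1) / 2) c k * ((1 / (4 * x ^ 2) : ℝ) * (y : ℂ) ^ 2) ^ k) * key

/-- Termwise Mellin transform of `F₃` times an even entire series `∑ wₖ (q y²)ᵏ`. -/
lemma mellin_appellF3Curve_mul_tsum {a a' b b' c s : ℂ} (hc : 0 < c.re) (ha : 0 < (s + a').re)
    (hb : 0 < (s + b').re) (hab : 0 < (s + c - a - b).re) {w : ℕ → ℂ} {q : ℝ} (hq : 0 ≤ q)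
    (hw : ∀ R : ℝ, 0 ≤ R → Summable fun k => ‖w k‖ * R ^ k) :
    IntegrableOn (fun y : ℝ => (y : ℂ) ^ (s - 1) * (1 - (y : ℂ)) ^ (c - 1) *
      appellF3Curve a a' b b' c y * ∑' k : ℕ, w k * (q * (y : ℂ) ^ 2) ^ k) (Set.Ioo 0 1) ∧
    ∫ y in Set.Ioo (0 : ℝ) 1, (y : ℂ) ^ (s - 1) * (1 - (y : ℂ)) ^ (c - 1) *
      appellF3Curve a a' b b' c y * ∑' k : ℕ, w k * (q * (y : ℂ) ^ 2) ^ k =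
        ∑' k : ℕ, w k * (q : ℂ) ^ k * curveMellin a a' b b' c (s + (2 * k : ℕ)) := by
  have hmel : ∀ k : ℕ, _ := fun k => mellin_appellF3Curve (a := a) (a' := a') (b := b) (b' := b')
    (c := c) (s := s + (2 * k : ℕ)) hc
    (by rw [add_right_comm, Complex.add_re, Complex.natCast_re]; positivity)
    (by rw [add_right_comm, Complex.add_re, Complex.natCast_re]; positivity)
    (by
      rw [show s + (2 * k : ℕ) + c - a - b = s + c - a - b + (2 * k : ℕ) by ring, Complex.add_re,
        Complex.natCast_re]
      positivity)
  set M : ℝ → ℂ := fun y => (y : ℂ) ^ (s - 1) * (1 - (y : ℂ)) ^ (c - 1) *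
    appellF3Curve a a' b b' c y with hM
  set F : ℕ → ℝ → ℂ := fun k y => w k * (q : ℂ) ^ k * ((y : ℂ) ^ (s + (2 * k : ℕ) - 1) *
    (1 - (y : ℂ)) ^ (c - 1) * appellF3Curve a a' b b' c y) with hF
  have hMint : IntegrableOn M (Set.Ioo 0 1) := (mellin_appellF3Curve hc ha hb hab).1
  have hFM : ∀ k, ∀ y ∈ Set.Ioo (0 : ℝ) 1, F k y = M y * (w k * (q * (y : ℂ) ^ 2) ^ k) := by
    intro k y hy
    have hyc : (y : ℂ) ≠ 0 := by exact_mod_cast hy.1.ne'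
    simp only [hF, hM]
    rw [show s + ((2 * k : ℕ) : ℂ) - 1 = s - 1 + (2 * k : ℕ) by ring, Complex.cpow_add _ _ hyc,
      Complex.cpow_natCast, mul_pow, ← pow_mul]
    ring
  have hint : ∀ k, Integrable (F k) (volume.restrict (Set.Ioo (0 : ℝ) 1)) := fun k =>
    Integrable.const_mul (hmel k).1 _
  have hnorm : Summable fun k => ∫ y in Set.Ioo (0 : ℝ) 1, ‖F k y‖ := by
    refine Summable.of_nonneg_of_le (fun _ => integral_nonneg fun _ => norm_nonneg _) (fun k => ?_)
      ((hw q hq).mul_right (∫ y in Set.Ioo (0 : ℝ) 1, ‖M y‖))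
    rw [← integral_const_mul]
    refine setIntegral_mono_on (hint k).norm (hMint.norm.const_mul _) measurableSet_Ioo fun y hy => ?_
    rw [hFM k y hy, norm_mul (M y), norm_mul (w k), norm_pow ((q : ℂ) * _), norm_mul (q : ℂ),
      norm_pow (y : ℂ), Complex.norm_real,
      Complex.norm_real, Real.norm_of_nonneg hq, Real.norm_of_nonneg hy.1.le, mul_comm]
    gcongr
    exact mul_le_of_le_one_right hq (pow_le_one₀ hy.1.le hy.2.le)
  have hpt : ∀ᵐ y : ℝ ∂(volume.restrict (Set.Ioo (0 : ℝ) 1)), HasSum (fun k => F k y)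
      (M y * ∑' k : ℕ, w k * (q * (y : ℂ) ^ 2) ^ k) := by
    refine (ae_restrict_iff' measurableSet_Ioo).2 (Eventually.of_forall fun y hy => ?_)
    simp only [fun k => hFM k y hy]
    refine HasSum.mul_left _ (Summable.hasSum (Summable.of_norm_bounded
      (hw ‖(q : ℂ) * (y : ℂ) ^ 2‖ (norm_nonneg _)) fun k => ?_))
    rw [norm_mul, norm_pow]
  refine ⟨integrable_of_hasSum_of_summable_integral_norm hint hnorm hpt, ?_⟩
  have hS := hasSum_integral_of_summable_integral_norm hint hnorm
  have e : ∫ y in Set.Ioo (0 : ℝ) 1, M y * ∑' k : ℕ, w k * (q * (y : ℂ) ^ 2) ^ k =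
      ∫ y in Set.Ioo (0 : ℝ) 1, ∑' k, F k y :=
    integral_congr_ae (hpt.mono fun y hy => hy.tsum_eq.symm)
  rw [e, ← hS.tsum_eq]
  refine tsum_congr fun k => ?_
  rw [← (hmel k).2, ← integral_const_mul]

theorem theorem4 (α α' β β' γ ρ p b c κ : ℂ) (x : ℝ) (hx : 0 < x)
    (hκ : κ = p + (b + 1) / 2) (hκ0 : ∀ n : ℕ, κ ≠ -(n : ℂ))
    (hγ : 0 < γ.re)
    (hρ : (ρ - p).re < 1 + min (-β).re (min (α + α' - γ).re (α + β' - γ).re))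
    -- no denominator parameter of the hypergeometric series is zero or a negative integer
    (h1 : ∀ n : ℕ, p - ρ + 1 ≠ -(n : ℂ))
    (h2 : ∀ n : ℕ, α + α' + β' + p - γ - ρ + 1 ≠ -(n : ℂ))
    (h3 : ∀ n : ℕ, α - β + p - ρ + 1 ≠ -(n : ℂ)) :
    IntegrableOn
      (msmRightIntegrand α α' β β' γ
        (fun t : ℝ => (t : ℂ) ^ (ρ - 1) * genBessel p b c (1 / (t : ℂ))) x) (Set.Ioi x) ∧
    msmRight α α' β β' γ (fun t : ℝ => (t : ℂ) ^ (ρ - 1) * genBessel p b c (1 / (t : ℂ))) x =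
      (x : ℂ) ^ (ρ - p - α - α' + γ - 1) / 2 ^ p *
      (Complex.Gamma (α + α' + p - γ - ρ + 1) * Complex.Gamma (α + β' - γ + p - ρ + 1) *
          Complex.Gamma (-β + p - ρ + 1) /
        (Complex.Gamma (p - ρ + 1) * Complex.Gamma κ *
          Complex.Gamma (α + α' + β' + p - γ - ρ + 1) * Complex.Gamma (α - β + p - ρ + 1))) *
      genHyp
        [(α + α' + p - γ - ρ + 1) / 2, (α + α' + p - γ - ρ + 2) / 2,
          (α + β' + p - γ - ρ + 1) / 2, (α + β' + p - γ - ρ + 2) / 2,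
          (-β + p - ρ + 1) / 2, (-β + p - ρ + 2) / 2]
        [κ, (p - ρ + 1) / 2, (p - ρ + 2) / 2,
          (α + α' + β' + p - γ - ρ + 1) / 2, (α + α' + β' + p - γ - ρ + 2) / 2,
          (α - β + p - ρ + 1) / 2, (α - β + p - ρ + 2) / 2]
        (-(c / (4 * (x : ℂ) ^ 2))) := by
  set s := α - γ - ρ + p + 1 with hs
  have hmin1 := min_le_left (-β).re (min (α + α' - γ).re (α + β' - γ).re)
  have hmin2 := (min_le_right (-β).re (min (α + α' - γ).re (α + β' - γ).re)).trans (min_le_left _ _)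
  have hmin3 := (min_le_right (-β).re (min (α + α' - γ).re (α + β' - γ).re)).trans (min_le_right _ _)
  simp only [Complex.add_re, Complex.sub_re, Complex.neg_re] at hρ hmin1 hmin2 hmin3
  have ha : 0 < (s + α').re := by
    simp only [hs, Complex.add_re, Complex.sub_re, Complex.one_re]
    linarith
  have hb : 0 < (s + β').re := by
    simp only [hs, Complex.add_re, Complex.sub_re, Complex.one_re]
    linarith
  have hab : 0 < (s + γ - α - β).re := by
    simp only [hs, Complex.add_re, Complex.sub_re, Complex.one_re]
    linarith
  have r1 : s + α' = α + α' + p - γ - ρ + 1 := by rw [hs]; ring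
  have r2 : s + β' = α + β' + p - γ - ρ + 1 := by rw [hs]; ring
  have r3 : s + γ - α - β = -β + p - ρ + 1 := by rw [hs]; ring
  have r4 : s + γ - α = p - ρ + 1 := by rw [hs]; ring
  have r5 : s + α' + β' = α + α' + β' + p - γ - ρ + 1 := by rw [hs]; ring
  have r6 : s + γ - β = α - β + p - ρ + 1 := by rw [hs]; ring
  obtain ⟨hI, hV⟩ := mellin_appellF3Curve_mul_tsum hγ ha hb hab
    (show (0 : ℝ) ≤ 1 / (4 * x ^ 2) by positivity)
    (fun R hR => summable_norm_besselCoeff (p + (b + 1) / 2) c hR)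
  have hcongr : ∀ y ∈ Set.Ioo (0 : ℝ) 1, _ := fun y hy =>
    msmRightIntegrand_div α α' β β' γ ρ p b c hx hy
  constructor
  · rw [← image_div_Ioo hx, integrableOn_image_iff_integrableOn_abs_deriv_smul measurableSet_Ioo
      (fun y hy => hasDerivWithinAt_div hy) (injOn_div hx)]
    exact IntegrableOn.congr_fun (Integrable.const_mul hI _) (fun y hy => (hcongr y hy).symm)
      measurableSet_Ioo
  rw [msmRight, ← image_div_Ioo hx, integral_image_eq_integral_abs_deriv_smul measurableSet_Ioo
    (fun y hy => hasDerivWithinAt_div hy) (injOn_div hx), setIntegral_congr_fun measurableSet_Ioo hcongr,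
    integral_const_mul, hV, ← hκ]
  have hterm : ∀ k : ℕ, besselCoeff κ c k * ((1 / (4 * x ^ 2) : ℝ) : ℂ) ^ k *
      curveMellin α α' β β' γ (s + (2 * k : ℕ)) =
      curveMellin α α' β β' γ s * (Complex.Gamma κ)⁻¹ *
        (([(α + α' + p - γ - ρ + 1) / 2, (α + α' + p - γ - ρ + 2) / 2,
          (α + β' + p - γ - ρ + 1) / 2, (α + β' + p - γ - ρ + 2) / 2,
          (-β + p - ρ + 1) / 2, (-β + p - ρ + 2) / 2].map fun a => poch a k).prod /
        (([κ, (p - ρ + 1) / 2, (p - ρ + 2) / 2,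
          (α + α' + β' + p - γ - ρ + 1) / 2, (α + α' + β' + p - γ - ρ + 2) / 2,
          (α - β + p - ρ + 1) / 2, (α - β + p - ρ + 2) / 2].map fun b => poch b k).prod * poch 1 k) *
          (-(c / (4 * (x : ℂ) ^ 2))) ^ k) := by
    intro k
    have h := besselCoeff_mul_curveMellin ha hb hab (by rwa [r4]) (by rwa [r5]) (by rwa [r6]) hκ0 c x k
    rw [r5, r3, r1, r2, r4, r6] at h
    simpa only [add_assoc _ (1 : ℂ) 1, one_add_one_eq_two] using h
  rw [tsum_congr hterm, tsum_mul_left, genHyp, curveMellin, r5, r3, r1, r2, r4, r6]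
  have hxc : (x : ℂ) ≠ 0 := by exact_mod_cast hx.ne'
  have hG := Complex.Gamma_ne_zero_of_re_pos hγ
  have hpow : (x : ℂ) ^ (ρ - p - α - α' + γ - 1) = (x : ℂ) ^ (-α') * (x : ℂ) ^ (γ - α + ρ - p - 1) := by
    rw [← Complex.cpow_add _ _ hxc]
    congr 1
    ring
  rw [hpow, show α + β' - γ + p - ρ + 1 = α + β' + p - γ - ρ + 1 by ring]
  have hfinal : ∀ X Y Z G G1 G2 G3 G4 G5 G6 K S : ℂ, G ≠ 0 →
      X / G * (Y / Z * (G * G1 * G2 * G3 * G4⁻¹ * G5⁻¹ * G6⁻¹ * K⁻¹ * S)) =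
        X * Y / Z * (G1 * G2 * G3 / (G4 * K * G5 * G6)) * S := by
    intro X Y Z G G1 G2 G3 G4 G5 G6 K S h
    simp only [div_eq_mul_inv, mul_inv]
    linear_combination (X * Y * Z⁻¹ * G1 * G2 * G3 * G4⁻¹ * G5⁻¹ * G6⁻¹ * K⁻¹ * S) *
      inv_mul_cancel₀ h
  exact hfinal _ _ _ _ _ _ _ _ _ _ _ _ hG
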